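/- A Markov automaton (MA) $\mathcal M$ consists of a finite nonempty set $S$ of states with an initial state $s_0$, a finite set $A$ of actions, a probabilistic transition relation contained in $S\times A\times \mathrm{Distr}(S)$, and a Markovian transition relation contained in $S\times\mathbb R_{>0}\times S$ (with finite total rates). All actions are internal, so probabilistic transitions take no time and take precedence over Markovian ones. Let $\mathit{PS}$ be the set of states with a probabilistic transition and $\mathit{MS}$ the set of states with a Markovian transition and no probabilistic one. Let $\mathbf R(s,s')$ be the sum of the rates $r$ of the Markovian transitions $(s,r,s')$, let $E(s)=\sum_{s'}\mathbf R(s,s')$, and for $s\in\mathit{MS}$ let $\mathbf P(s,s')=\mathbf R(s,s')/E(s)$. In $s\in\mathit{MS}$ the MA stays for an exponentially distributed time with rate $E(s)$ and, independently, moves to $s'$ with probability $\mathbf P(s,s')$; in $s\in \mathit{PS}$ a policy chooses (possibly randomly, as a measurable function of the finite timed path so far) an enabled probabilistic transition $(s,\alpha,\mu)$, and the next state is drawn from $\mu$ without delay. A state without any transition idles forever. For $G\subseteq S$ and $b\ge 0$ let $p^{\mathcal M}_{\max}(s,\Diamond^{[0,b]}G)$ be the supremum, over all such general measurable policies, of the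 probability that a path started in $s$ visits $G$ at some time in $[0,b]$. For $\delta>0$ the digitised MA $\mathcal M_\delta$ has the same states and probabilistic transitions, and in each $s\in\mathit{MS}$ one digitised Markovian transition with distribution $\mu^s(s')=(1-e^{-E(s)\delta})\,\mathbf P(s,s')$ for $s'\ne s$ and $\mu^s(s)=(1-e^{-E(s)\delta})\,\mathbf P(s,s)+e^{-E(s)\delta}$. Each digitised Markovian transition counts as one step, and probabilistic transitions count as none. Let $p^{\mathcal M_\delta}_{\max}(s,\Diamond^{[0,k]}G)$ be the supremum, over all time-abstract policies (which choose, possibly randomly, on the basis of the time-abstract finite path so far), of the probability that a path of $\mathcal M_\delta$ started in $s$ visits $G$ within $k$ steps. **Theorem.** Let $\mathcal M$ be an MA, $G\subseteq S$, and $\lambda=\max_{s\in\mathit{MS}}E(s)$ (with $\lambda=0$ if $\mathit{MS}=\emptyset$). Let $b\ge 0$ and $\delta>0$ be such that $b=k_b\delta$ for some $k_b\in\mathbb N$ ($k_b = 0$ allowed). Then for all $s\in S$ $$p^{\mathcal M_\delta}_{\max}(s,\Diamond^{[0,k_b]}G)\ \le\ p^{\mathcal M}_{\max}(s,\Diamond^{[0,b]}G)\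 \le\ p^{\mathcal M_\delta}_{\max}(s,\Diamond^{[0,k_b]}G)+1-e^{-\lambda b}(1+\lambda\delta)^{k_b}.$$ -/

import Mathlib

open MeasureTheory ProbabilityTheory

open scoped NNReal ENNReal

noncomputable section

namespace MA

universe u v

/-! ### Distributions over a finite set -/

/-- Probability distributions over the finite set `S`: functions `μ : S → ℝ` with
`μ s ≥ 0` and `∑ s, μ s = 1`. -/
abbrev Distr (S : Type u) [Fintype S] : Type u := stdSimplex ℝ S

open scoped Classical in
/-- The Dirac distribution at `s`. -/
def Distr.dirac {S : Type u} [Fintype S] (s : S) : Distr S :=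
  ⟨Pi.single s 1, single_mem_stdSimplex ℝ s⟩

/-- The random choice of a state according to a distribution, as a Markov kernel. -/
def sampleKernel (S : Type u) [Fintype S] [MeasurableSpace S] : Kernel (Distr S) S where
  toFun μ := ∑ s : S, ENNReal.ofReal (μ.1 s) • Measure.dirac s
  measurable' := by
    refine Measure.measurable_of_measurable_coe _ fun B _ => ?_
    simp only [Measure.finsetSum_apply, Measure.smul_apply, smul_eq_mul]
    refine Finset.measurable_sum _ fun s _ => Measurable.mul_const ?_ _
    exact ENNReal.measurable_ofReal.comp ((measurable_pi_apply s).comp measurable_subtype_coe)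

instance (S : Type u) [Fintype S] [MeasurableSpace S] : IsMarkovKernel (sampleKernel S) := by
  refine ⟨fun μ => ⟨?_⟩⟩
  have h : sampleKernel S μ = ∑ s : S, ENNReal.ofReal (μ.1 s) • Measure.dirac s := rfl
  rw [h]
  simp only [Measure.finsetSum_apply, Measure.smul_apply, smul_eq_mul, measure_univ, mul_one]
  rw [← ENNReal.ofReal_sum_of_nonneg (fun s _ => μ.2.1 s), μ.2.2, ENNReal.ofReal_one]

/-! ### Labels of moves -/

/-- The label of a move: an action `a`, or the label `⊥` of a Markovian move. -/
inductive Move (A : Type v) : Type v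
  | act (a : A) : Move A
  | bot : Move A

instance (A : Type v) : MeasurableSpace (Move A) := ⊤

instance (A : Type v) : DiscreteMeasurableSpace (Move A) := ⟨fun _ => trivial⟩

instance (A : Type v) [Finite A] : Finite (Move A) :=
  Finite.of_surjective (fun o : Option A => o.elim Move.bot Move.act)
    (fun m => by cases m with
      | act a => exact ⟨some a, rfl⟩
      | bot => exact ⟨none, rfl⟩)

/-- One entry of a time-abstract path `s₀ --(σ₀, μ₀)--> s₁ --(σ₁, μ₁)--> ⋯`. Entry `i + 1` is
`((σᵢ, μᵢ), sᵢ₊₁)`: the state `sᵢ₊₁` with the move that led into it. Entry `0` holds the initial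
state `s₀` with a dummy move. -/
abbrev Entry (S : Type u) (A : Type v) [Fintype S] : Type (max u v) := (Move A × Distr S) × S

/-- One entry of a timed path `s₀ --(σ₀, μ₀, t₀)--> s₁ --(σ₁, μ₁, t₁)--> ⋯`. Entry `i + 1` is
`(((σᵢ, μᵢ), sᵢ₊₁), tᵢ)`, where `tᵢ` is the time spent in `sᵢ`. Entry `0` holds the initial
state `s₀` with a dummy move and time `0`. -/
abbrev TimedEntry (S : Type u) (A : Type v) [Fintype S] : Type (max u v) := Entry S A × ℝ≥0

/-- Finite paths with `n` moves. -/
abbrev Hist (X : Type*) (n : ℕ) := (i : Finset.Iic n) → (fun _ : ℕ => X) i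

/-- The last entry of a finite path. -/
def Hist.last {X : Type*} {n : ℕ} (h : Hist X n) : X := h ⟨n, Finset.mem_Iic.2 le_rfl⟩

lemma Hist.measurable_last {X : Type*} [MeasurableSpace X] {n : ℕ} :
    Measurable (Hist.last : Hist X n → X) :=
  measurable_pi_apply (X := fun _ : Finset.Iic n => X) _

end MA

/-! ### Markov automata -/

/-- A Markov automaton with finite state set `S` and finite action set `A`. -/
structure MarkovAutomaton (S : Type*) (A : Type*) [Fintype S] where
  /-- The probabilistic transition relation. -/
  it : S → A → MA.Distr S → Prop
  /-- The Markovian transition relation. -/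
  mt : S → ℝ → S → Prop
  /-- Rates are positive. -/
  rate_pos : ∀ s r s', mt s r s' → 0 < r
  /-- The total rate from `s` to `s'` is finite. -/
  rate_summable : ∀ s s', Summable (fun r : {r : ℝ // mt s r s'} => (r : ℝ))
  /-- The initial state. -/
  init : S

namespace MarkovAutomaton

open MA

variable {S : Type*} {A : Type*} [Fintype S] (M : MarkovAutomaton S A)

/-- `PS`: the states with an outgoing probabilistic transition. -/
def PS : Set S := {s | ∃ a μ, M.it s a μ}

/-- `MS`: the Markovian states. Since probabilistic transitions are taken immediately, these are
the states with a Markovian transition and without probabilistic ones. -/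
def MS : Set S := {s | s ∉ M.PS ∧ ∃ r s', M.mt s r s'}

/-- The total rate `R(s, s')` to move from `s` to `s'`. -/
def rate (s s' : S) : ℝ := ∑' r : {r : ℝ // M.mt s r s'}, (r : ℝ)

/-- The exit rate `E(s)`. -/
def exitRate (s : S) : ℝ := ∑ s', M.rate s s'

/-- The maximal exit rate of a Markovian state (`0` if there is no Markovian state). -/
def maxExitRate : ℝ := ⨆ s : M.MS, M.exitRate s

lemma rate_nonneg (s s' : S) : 0 ≤ M.rate s s' :=
  tsum_nonneg fun r => (M.rate_pos s _ s' r.2).le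

lemma exitRate_nonneg (s : S) : 0 ≤ M.exitRate s :=
  Finset.sum_nonneg fun s' _ => M.rate_nonneg s s'

lemma exitRate_pos {s : S} (hs : s ∈ M.MS) : 0 < M.exitRate s := by
  obtain ⟨-, r, s', h⟩ := hs
  refine Finset.sum_pos' (fun x _ => M.rate_nonneg s x) ⟨s', Finset.mem_univ _, ?_⟩
  exact (M.rate_summable s s').tsum_pos (fun r => (M.rate_pos s _ s' r.2).le) ⟨r, h⟩
    (M.rate_pos s r s' h)

open scoped Classical in
/-- The distribution `P(s, ·) = R(s, ·) / E(s)` of the successor of a Markovian state `s`.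
A state that is not Markovian gets the Dirac distribution at itself; this value is used only for
states without any transition, which are understood to idle forever. -/
def jump (s : S) : Distr S :=
  if h : s ∈ M.MS then
    ⟨fun s' => M.rate s s' / M.exitRate s,
      fun s' => div_nonneg (M.rate_nonneg s s') (M.exitRate_nonneg s), by
        rw [← Finset.sum_div]; exact div_self (M.exitRate_pos h).ne'⟩
  else Distr.dirac s

/-- The moves available in `s`: the enabled probabilistic transitions if there are any, and
otherwise the Markovian move. -/
def Enabled (s : S) : Move A × Distr S → Prop
  | (Move.act a, μ) => M.it s a μ
  | (Move.bot, μ) => s ∉ M.PS ∧ μ = M.jump s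

open scoped Classical in
/-- The law of the sojourn time in `s` before a move: zero for actions, exponential
with rate `E(s)` for the Markovian move of a Markovian state. (A state without transitions
idles in rounds of length one.) -/
def sojourn (s : S) : Move A → Measure ℝ≥0
  | Move.act _ => Measure.dirac 0
  | Move.bot =>
      if s ∈ M.MS then (expMeasure (M.exitRate s)).map Real.toNNReal else Measure.dirac 1

variable [MeasurableSpace S] [DiscreteMeasurableSpace S] [Finite A]

/-- The sojourn time as a kernel. -/
def sojournKernel : Kernel (S × Move A) ℝ≥0 where
  toFun x := M.sojourn x.1 x.2
  measurable' := Measurable.of_discrete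

instance : IsMarkovKernel M.sojournKernel := by
  refine ⟨fun x => ?_⟩
  change IsProbabilityMeasure (M.sojourn x.1 x.2)
  rcases x with ⟨s, _ | _⟩
  · exact Measure.dirac.isProbabilityMeasure
  · simp only [sojourn]
    split_ifs with h
    · have := isProbabilityMeasure_expMeasure (M.exitRate_pos h)
      exact Measure.isProbabilityMeasure_map measurable_real_toNNReal.aemeasurable
    · exact Measure.dirac.isProbabilityMeasure

/-- A general measurable policy: for each finite timed path it gives, measurably, a probability
distribution over the moves enabled in the last state. -/
structure Policy where
  /-- The choice after a finite path with `n` moves. -/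
  choice (n : ℕ) : Kernel (Hist (TimedEntry S A) n) (Move A × Distr S)
  markov (n : ℕ) : IsMarkovKernel (choice n)
  enabled (n : ℕ) (h : Hist (TimedEntry S A) n) :
    ∀ᵐ x ∂(choice n h), M.Enabled h.last.1.2 x

namespace Policy

variable {M} (D : M.Policy)

instance (n : ℕ) : IsMarkovKernel (D.choice n) := D.markov n

/-- The law of the next entry of a path: the policy chooses a move `(σ, μ)`, the next state is
drawn from `μ`, and the time spent in the current state is drawn independently. -/
def step (n : ℕ) : Kernel (Hist (TimedEntry S A) n) (TimedEntry S A) :=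
  (D.choice n ⊗ₖ (sampleKernel S).comap (fun x => x.2.2) (by fun_prop)) ⊗ₖ
    M.sojournKernel.comap (fun x => (x.1.last.1.2, x.2.1.1))
      ((measurable_snd.comp (measurable_fst.comp (Hist.measurable_last.comp measurable_fst))).prodMk
        (by fun_prop))

instance (n : ℕ) : IsMarkovKernel (D.step n) := by
  unfold step; infer_instance

/-- The probability measure `Pr_{s,D}` on infinite timed paths. -/
def pathMeasure (s : S) : Measure (ℕ → TimedEntry S A) :=
  Kernel.traj (X := fun _ => TimedEntry S A) D.step 0
    (fun _ => (((Move.bot, Distr.dirac s), s), 0))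

instance (s : S) : IsProbabilityMeasure (D.pathMeasure s) := by
  unfold pathMeasure; infer_instance

end Policy

/-- The time at which the `i`-th state of a path is entered. -/
def entryTime (π : ℕ → TimedEntry S A) (i : ℕ) : ℝ≥0 := ∑ j ∈ Finset.range i, (π (j + 1)).2

/-- `◇^{[0,b]} G`: the paths that reach a state of `G` within the time interval `[0, b]`. -/
def timedReach (G : Set S) (b : ℝ) : Set (ℕ → TimedEntry S A) :=
  {π | ∃ i, (π i).1.2 ∈ G ∧ (entryTime π i : ℝ) ≤ b}

/-- The maximal probability `p_max(s, ◇^{[0,b]} G)` over all general measurable policies. -/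
def pMax (s : S) (G : Set S) (b : ℝ) : ℝ :=
  ⨆ D : M.Policy, (D.pathMeasure s).real (timedReach G b)

end MarkovAutomaton

/-! ### Digitised Markov automata -/

/-- A digitised Markov automaton: probabilistic transitions as in a Markov automaton, and
digitised Markovian transitions, each of which takes one digitisation step. -/
structure DigitisedMA (S : Type*) (A : Type*) [Fintype S] where
  /-- The probabilistic transition relation. -/
  it : S → A → MA.Distr S → Prop
  /-- The digitised Markovian transition relation. -/
  mt : S → MA.Distr S → Prop
  /-- The initial state. -/
  init : S

namespace DigitisedMA

open MA

variable {S : Type*} {A : Type*} [Fintype S] (N : DigitisedMA S A)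

/-- The moves available in `s`: the enabled probabilistic transitions if there are any, otherwise
the digitised Markovian transitions; a state without any transition idles forever. -/
def Enabled (s : S) : Move A × Distr S → Prop
  | (Move.act a, μ) => N.it s a μ
  | (Move.bot, μ) => (¬ ∃ a ν, N.it s a ν) ∧ (N.mt s μ ∨ ((¬ ∃ ν, N.mt s ν) ∧ μ = Distr.dirac s))

variable [MeasurableSpace S] [DiscreteMeasurableSpace S] [Finite A]

/-- A time-abstract policy: for each finite time-abstract path it gives a probability
distribution over the moves enabled in the last state. -/
structure Policy where
  /-- The choice after a finite path with `n` moves. -/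
  choice (n : ℕ) : Kernel (Hist (Entry S A) n) (Move A × Distr S)
  markov (n : ℕ) : IsMarkovKernel (choice n)
  enabled (n : ℕ) (h : Hist (Entry S A) n) : ∀ᵐ x ∂(choice n h), N.Enabled h.last.2 x

namespace Policy

variable {N} (D : N.Policy)

instance (n : ℕ) : IsMarkovKernel (D.choice n) := D.markov n

/-- The law of the next entry of a path: the policy chooses a move `(σ, μ)` and the next state is
drawn from `μ`. -/
def step (n : ℕ) : Kernel (Hist (Entry S A) n) (Entry S A) :=
  D.choice n ⊗ₖ (sampleKernel S).comap (fun x => x.2.2) (by fun_prop)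

instance (n : ℕ) : IsMarkovKernel (D.step n) := by
  unfold step; infer_instance

/-- The probability measure on infinite time-abstract paths. -/
def pathMeasure (s : S) : Measure (ℕ → Entry S A) :=
  Kernel.traj (X := fun _ => Entry S A) D.step 0 (fun _ => ((Move.bot, Distr.dirac s), s))

instance (s : S) : IsProbabilityMeasure (D.pathMeasure s) := by
  unfold pathMeasure; infer_instance

end Policy

open scoped Classical in
/-- The number of digitisation steps before the `i`-th state of a path is entered: the number of
Markovian moves, as probabilistic moves take no time. -/
def stepCount (π : ℕ → Entry S A) (i : ℕ) : ℕ :=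
  ((Finset.range i).filter fun j => (π (j + 1)).1.1 = Move.bot).card

/-- `◇^{[0,k]} G`: the paths that reach a state of `G` within `k` digitisation steps. -/
def stepReach (G : Set S) (k : ℕ) : Set (ℕ → Entry S A) :=
  {π | ∃ i, (π i).2 ∈ G ∧ stepCount π i ≤ k}

/-- The maximal probability `p_max(s, ◇^{[0,k]} G)` over all time-abstract policies. -/
def pMax (s : S) (G : Set S) (k : ℕ) : ℝ :=
  ⨆ D : N.Policy, (D.pathMeasure s).real (stepReach G k)

end DigitisedMA

namespace MarkovAutomaton

open MA

variable {S : Type*} {A : Type*} [Fintype S] (M : MarkovAutomaton S A)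

open scoped Classical in
/-- The distribution `μ^s` of the digitised transition of `s` for the digitisation constant `δ`. -/
def digitJump (δ : ℝ) (hδ : 0 < δ) (s : S) : Distr S :=
  ⟨fun s' =>
      if s' ≠ s then (1 - Real.exp (-(M.exitRate s * δ))) * (M.jump s).1 s'
      else (1 - Real.exp (-(M.exitRate s * δ))) * (M.jump s).1 s' + Real.exp (-(M.exitRate s * δ)),
    by
      have h1 : 0 ≤ 1 - Real.exp (-(M.exitRate s * δ)) := by
        rw [sub_nonneg, Real.exp_le_one_iff, neg_nonpos]
        exact mul_nonneg (M.exitRate_nonneg s) hδ.le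
      have hP := (M.jump s).2
      refine ⟨fun s' => ?_, ?_⟩
      · have := mul_nonneg h1 (hP.1 s')
        have := Real.exp_pos (-(M.exitRate s * δ))
        dsimp only
        split_ifs <;> linarith
      · have : ∀ s', (if s' ≠ s then (1 - Real.exp (-(M.exitRate s * δ))) * (M.jump s).1 s'
            else (1 - Real.exp (-(M.exitRate s * δ))) * (M.jump s).1 s'
              + Real.exp (-(M.exitRate s * δ)))
            = (1 - Real.exp (-(M.exitRate s * δ))) * (M.jump s).1 s'
              + if s' = s then Real.exp (-(M.exitRate s * δ)) else 0 := by
          intro s'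
          by_cases h : s' = s <;> simp [h]
        simp only [this, Finset.sum_add_distrib, ← Finset.mul_sum, hP.2]
        simp⟩

/-- The digitised automaton `M_δ`: the Markovian transitions are replaced by
`{(s, μ^s) | s ∈ MS}`. -/
def digitise (δ : ℝ) (hδ : 0 < δ) : DigitisedMA S A where
  it := M.it
  mt s μ := s ∈ M.MS ∧ μ = M.digitJump δ hδ s
  init := M.init

end MarkovAutomaton

end

/-! Both inequalities follow from functions that are monotone in expectation along every move. A
function that is at least 1 on the target, and whose expectation does not increase in a move made
outside it, bounds the reaching probability from above (`traj_reach_le`). Functions indexed by the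
number of remaining moves that lose at most `ε` per move, and vanish off the target when no move
remains, bound it from below up to the accumulated error (`le_traj_reach`). For the digitised
automaton this identifies the maximal probability with `value`, the limit of the Bellman iteration
`val`.

Lower bound: time `T` is read as `⌈T/δ⌉` steps, so that the timed and the digitised target agree.
Probabilistic choices are copied. In a Markovian state the digitised step is the exponential clock
observed at intervals of length `δ`: a jump within the interval is charged a full step, which is
never to the advantage of the digitised automaton, and without a jump the clock is memoryless
(`timedVal_succ_le_of_mem_MS`).

Upper bound: the digitisation loses only paths with two or more jumps in one interval. Let `q =
e^{-λδ}(1+λδ)` be the probability of at most one event of a Poisson process of rate `λ` in such an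
interval. From state `s` at time `cδ`, `G` is avoided with probability at least `q^{k-c} - value (s,
c)`; between grid points this is weighted by the probability that a clock of rate `λ` does not ring
before the next grid point. The resulting function `avoid`, truncated at zero, is sub-invariant
under all enabled moves (`avoid_le_timedGain`), hence `G` is reached with probability at most `value
(s, 0) + 1 - q^k`, and `q^k` is the constant of the theorem. The analytic input is a pair of
estimates for `oneJump` (`oneJump_le`, `le_oneJump_add`). -/

noncomputable section

namespace MA

/-! ### Reachability along a trajectory -/

section Trajectory

open Preorder Kernel Function

variable {X Y : Type*} {st : ℕ → (ℕ → X) → Y} {B : Set Y}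

/-- The paths whose status lies in `B` at some index up to `n`. -/
def reachedBy (st : ℕ → (ℕ → X) → Y) (B : Set Y) (n : ℕ) : Set (ℕ → X) :=
  {π | ∃ m ≤ n, st m π ∈ B}

lemma dependsOn_reachedBy (hdep : ∀ n, DependsOn (st n) (Set.Iic n)) (n : ℕ) {π π' : ℕ → X}
    (h : ∀ i ≤ n, π i = π' i) : π ∈ reachedBy st B n ↔ π' ∈ reachedBy st B n := by
  refine exists_congr fun m => and_congr_right fun hm => ?_
  rw [hdep m fun i hi => h i (le_trans hi hm)]

lemma reachedBy_mono : Monotone (reachedBy st B) :=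
  fun _ _ h _ ⟨m, hm, hB⟩ => ⟨m, hm.trans h, hB⟩

lemma iUnion_reachedBy : ⋃ n, reachedBy st B n = {π | ∃ n, st n π ∈ B} := by
  ext π
  simp only [Set.mem_iUnion, reachedBy, Set.mem_ofPred_eq]
  exact ⟨fun ⟨_, m, _, h⟩ => ⟨m, h⟩, fun ⟨m, h⟩ => ⟨m, m, le_rfl, h⟩⟩

open scoped Classical in
/-- The value of `W` at the status with index `n`, or `1` if `B` has been reached. -/
def stopped (st : ℕ → (ℕ → X) → Y) (B : Set Y) (W : Y → ℝ≥0∞) (n : ℕ) (π : ℕ → X) : ℝ≥0∞ :=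
  if π ∈ reachedBy st B n then 1 else W (st n π)

lemma dependsOn_stopped (hdep : ∀ n, DependsOn (st n) (Set.Iic n)) (W : Y → ℝ≥0∞) (n : ℕ) :
    DependsOn (stopped st B W n) (Set.Iic n) := by
  intro π π' h
  have hr : π ∈ reachedBy st B n ↔ π' ∈ reachedBy st B n := dependsOn_reachedBy hdep n h
  by_cases hπ : π ∈ reachedBy st B n
  · simp [stopped, hπ, hr.1 hπ]
  · simp [stopped, hπ, mt hr.2 hπ, hdep n h]

lemma update_mem_reachedBy (hdep : ∀ n, DependsOn (st n) (Set.Iic n)) {n : ℕ} {π : ℕ → X}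
    (h : π ∈ reachedBy st B n) (x : X) : update π (n + 1) x ∈ reachedBy st B (n + 1) := by
  refine reachedBy_mono n.le_succ ((dependsOn_reachedBy hdep n fun i hi => ?_).1 h)
  rw [update_of_ne (by omega)]

variable [MeasurableSpace X] {κ : (n : ℕ) → Kernel (Hist X n) X} [∀ n, IsMarkovKernel (κ n)]

/-- The integral over the next entry of a path. -/
def nextLIntegral (κ : (n : ℕ) → Kernel (Hist X n) X) (n : ℕ) (f : (ℕ → X) → ℝ≥0∞) (π : ℕ → X) :
    ℝ≥0∞ :=
  ∫⁻ x, f (update π (n + 1) x) ∂κ n (frestrictLe (π := fun _ => X) n π)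

/-- Reduces integrals over infinite paths to iterated integrals over finitely many entries, where
one can induct on the number of moves. -/
lemma lintegral_traj_eq_lmarginalPartialTraj (π₀ : ℕ → X) {n : ℕ} {f : (ℕ → X) → ℝ≥0∞}
    (hf : Measurable f) (hdep : DependsOn f (Set.Iic n)) :
    ∫⁻ π, f π ∂traj (X := fun _ => X) κ 0 (frestrictLe 0 π₀) =
      lmarginalPartialTraj (X := fun _ => X) κ 0 n f π₀ := by
  rw [lmarginalPartialTraj, ← traj_map_frestrictLe_apply,
    lintegral_map (f := fun z => f (updateFinset π₀ (Finset.Iic n) z))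
      (hf.comp measurable_updateFinset) (measurable_frestrictLe _)]
  refine lintegral_congr fun π => hdep fun i hi => ?_
  have : i ≤ n := hi
  simp [updateFinset, this]

lemma lmarginalPartialTraj_succ_right (π₀ : ℕ → X) (n : ℕ) {f : (ℕ → X) → ℝ≥0∞}
    (hf : Measurable f) :
    lmarginalPartialTraj (X := fun _ => X) κ 0 (n + 1) f π₀ =
      lmarginalPartialTraj (X := fun _ => X) κ 0 n (nextLIntegral κ n f) π₀ := by
  rw [← lmarginalPartialTraj_self (X := fun _ => X) n.zero_le n.le_succ hf]
  congr 1
  funext π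
  exact lmarginalPartialTraj_succ (X := fun _ => X) n hf π

lemma lmarginalPartialTraj_le_of_step_le (π₀ : ℕ → X) {Ψ : ℕ → (ℕ → X) → ℝ≥0∞}
    (hΨ : ∀ n, Measurable (Ψ n)) (hstep : ∀ n π, nextLIntegral κ n (Ψ (n + 1)) π ≤ Ψ n π) (n : ℕ) :
    lmarginalPartialTraj (X := fun _ => X) κ 0 n (Ψ n) π₀ ≤ Ψ 0 π₀ := by
  induction n with
  | zero => rw [lmarginalPartialTraj_le _ le_rfl (hΨ 0)]
  | succ n ih =>
    rw [lmarginalPartialTraj_succ_right π₀ n (hΨ _)]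
    exact (lmarginalPartialTraj_mono _ _ (hstep n) _).trans ih

lemma le_lmarginalPartialTraj_of_le_step (π₀ : ℕ → X) {Ψ : ℕ → (ℕ → X) → ℝ≥0∞}
    (hΨ : ∀ n, Measurable (Ψ n)) {ε : ℝ≥0∞} {N : ℕ}
    (hstep : ∀ n < N, ∀ π, Ψ n π ≤ nextLIntegral κ n (Ψ (n + 1)) π + ε) {n : ℕ} (hn : n ≤ N) :
    Ψ 0 π₀ ≤ lmarginalPartialTraj (X := fun _ => X) κ 0 n (Ψ n) π₀ + n * ε := by
  induction n with
  | zero => simp [lmarginalPartialTraj_le (X := fun _ => X) κ le_rfl (hΨ 0)]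
  | succ n ih =>
    rw [lmarginalPartialTraj_succ_right π₀ n (hΨ _)]
    refine (ih (by omega)).trans ?_
    have h1 : lmarginalPartialTraj (X := fun _ => X) κ 0 n (Ψ n) π₀ ≤
        lmarginalPartialTraj (X := fun _ => X) κ 0 n (nextLIntegral κ n (Ψ (n + 1))) π₀ + ε := by
      refine (lmarginalPartialTraj_mono 0 n (hstep n (by omega)) _).trans_eq ?_
      rw [lmarginalPartialTraj, lmarginalPartialTraj, lintegral_add_right _ measurable_const]
      simp
    calc _ ≤ _ := add_le_add_left h1 _
      _ = _ := by push_cast; ring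

lemma nextLIntegral_stopped_of_reached (hdep : ∀ n, DependsOn (st n) (Set.Iic n)) {n : ℕ}
    {π : ℕ → X} (h : π ∈ reachedBy st B n) (W : Y → ℝ≥0∞) :
    nextLIntegral κ n (stopped st B W (n + 1)) π = 1 := by
  simp [nextLIntegral, stopped, update_mem_reachedBy hdep h]

variable [MeasurableSpace Y]

lemma measurableSet_reachedBy (hst : ∀ n, Measurable (st n)) (hB : MeasurableSet B) (n : ℕ) :
    MeasurableSet (reachedBy st B n) := by
  have : reachedBy st B n = ⋃ m ∈ Set.Iic n, st m ⁻¹' B := by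
    ext π; simp [reachedBy]
  rw [this]
  exact MeasurableSet.biUnion (Set.to_countable _) fun m _ => hst m hB

lemma measurable_stopped (hst : ∀ n, Measurable (st n)) (hB : MeasurableSet B) {W : Y → ℝ≥0∞}
    (hW : Measurable W) (n : ℕ) : Measurable (stopped st B W n) := by
  classical
  exact Measurable.ite (measurableSet_reachedBy hst hB n) measurable_const (hW.comp (hst n))

/-- A function that is excessive outside `B` and at least `1` on `B` bounds the probability of
reaching `B`. -/
theorem traj_reach_le (π₀ : ℕ → X) (hst : ∀ n, Measurable (st n))
    (hdep : ∀ n, DependsOn (st n) (Set.Iic n)) (hB : MeasurableSet B) {W : Y → ℝ≥0∞}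
    (hW : Measurable W) (hWB : ∀ y ∈ B, 1 ≤ W y)
    (hstep : ∀ n π, st n π ∉ B →
      nextLIntegral κ n (fun π' => W (st (n + 1) π')) π ≤ W (st n π)) :
    traj (X := fun _ => X) κ 0 (frestrictLe 0 π₀) {π | ∃ n, st n π ∈ B} ≤ W (st 0 π₀) := by
  have hs : ∀ n π, nextLIntegral κ n (stopped st B W (n + 1)) π ≤ stopped st B W n π := by
    intro n π
    by_cases h : π ∈ reachedBy st B n
    · rw [nextLIntegral_stopped_of_reached hdep h]
      simp [stopped, h]
    · have hn : st n π ∉ B := fun h' => h ⟨n, le_rfl, h'⟩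
      rw [show stopped st B W n π = W (st n π) by simp [stopped, h]]
      refine le_trans (lintegral_mono fun x => ?_) (hstep n π hn)
      by_cases h' : update π (n + 1) x ∈ reachedBy st B (n + 1)
      -- A hit at index `n + 1` is paid for by `W ≥ 1` on `B`; a hit at an earlier index does not
      -- see the new entry, so the old path would already have reached `B`.
      · obtain ⟨m, hm, hmB⟩ := h'
        rcases hm.eq_or_lt with rfl | hm
        · exact le_trans (by simp only [stopped]; split_ifs with h2
                             · exact hWB _ hmB
                             · exact le_rfl) le_rfl
        · refine absurd ⟨m, by omega, ?_⟩ h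
          rwa [hdep m (y := update π (n + 1) x)]
          intro i hi
          have : i ≤ m := hi
          rw [update_of_ne (by omega)]
      · simp [stopped, h']
  -- Continuity from below leaves a finite horizon, where the indicator of having reached `B` is at
  -- most the stopped function, a supermartingale.
  rw [← iUnion_reachedBy, reachedBy_mono.measure_iUnion]
  refine iSup_le fun n => ?_
  have h0 : stopped st B W 0 π₀ ≤ W (st 0 π₀) := by
    simp only [stopped]
    split_ifs with h
    · obtain ⟨m, hm, h⟩ := h
      obtain rfl : m = 0 := by omega
      exact hWB _ h
    · exact le_rfl
  refine le_trans ?_ ((lmarginalPartialTraj_le_of_step_le π₀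
    (measurable_stopped hst hB hW) hs n).trans h0)
  rw [← lintegral_traj_eq_lmarginalPartialTraj π₀ (measurable_stopped hst hB hW n)
    (dependsOn_stopped hdep W n), ← lintegral_indicator_one (measurableSet_reachedBy hst hB n)]
  refine lintegral_mono fun π => Set.indicator_le' (fun π h => ?_) (fun _ _ => bot_le) π
  simp [stopped, h]

/-- A function that is sub-invariant outside `B` and vanishes on `B` bounds the probability of
avoiding `B` from below. -/
theorem traj_reach_le_one_sub (π₀ : ℕ → X) (hst : ∀ n, Measurable (st n))
    (hdep : ∀ n, DependsOn (st n) (Set.Iic n)) (hB : MeasurableSet B) {a : Y → ℝ≥0∞}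
    (ha : Measurable a) (ha1 : ∀ y, a y ≤ 1) (haB : ∀ y ∈ B, a y = 0)
    (hstep : ∀ n π, st n π ∉ B →
      a (st n π) ≤ nextLIntegral κ n (fun π' => a (st (n + 1) π')) π) :
    traj (X := fun _ => X) κ 0 (frestrictLe 0 π₀) {π | ∃ n, st n π ∈ B} ≤ 1 - a (st 0 π₀) := by
  refine traj_reach_le (W := fun y => 1 - a y) π₀ hst hdep hB (measurable_const.sub ha)
    (fun y hy => by simp [haB y hy]) fun n π h => ?_
  have hm : Measurable fun x => a (st (n + 1) (update π (n + 1) x)) :=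
    ha.comp ((hst _).comp (measurable_update π))
  have hfin : ∫⁻ x, a (st (n + 1) (update π (n + 1) x)) ∂κ n (frestrictLe (π := fun _ => X) n π)
      ≠ ∞ := by
    refine ((lintegral_mono fun x => ha1 _).trans_lt ?_).ne
    simp
  rw [nextLIntegral, lintegral_sub hm hfin (.of_forall fun x => ha1 _)]
  simp only [MeasureTheory.lintegral_const, measure_univ, mul_one]
  exact tsub_le_tsub_left (hstep n π h) _

/-- Functions that lose at most `ε` per move outside `B` bound the probability of reaching `B`
from below. -/
theorem le_traj_reach (π₀ : ℕ → X) (hst : ∀ n, Measurable (st n))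
    (hdep : ∀ n, DependsOn (st n) (Set.Iic n)) (hB : MeasurableSet B) {W : ℕ → Y → ℝ≥0∞}
    (hW : ∀ n, Measurable (W n)) (hW1 : ∀ n y, W n y ≤ 1) (hW0 : ∀ y ∉ B, W 0 y = 0)
    {ε : ℝ≥0∞} {N : ℕ}
    (hstep : ∀ n < N, ∀ π, st n π ∉ B →
      W (N - n) (st n π) ≤
        nextLIntegral κ n (fun π' => W (N - (n + 1)) (st (n + 1) π')) π + ε) :
    W N (st 0 π₀) ≤
      traj (X := fun _ => X) κ 0 (frestrictLe 0 π₀) {π | ∃ n, st n π ∈ B} + N * ε := by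
  have hle : ∀ n π, W (N - n) (st n π) ≤ stopped st B (W (N - n)) n π := fun n π => by
    simp only [stopped]
    split_ifs
    exacts [hW1 _ _, le_rfl]
  have hs : ∀ n < N, ∀ π, stopped st B (W (N - n)) n π ≤
      nextLIntegral κ n (stopped st B (W (N - (n + 1))) (n + 1)) π + ε := by
    intro n hn π
    by_cases h : π ∈ reachedBy st B n
    · rw [nextLIntegral_stopped_of_reached hdep h]
      simp [stopped, h]
    · have hn' : st n π ∉ B := fun h' => h ⟨n, le_rfl, h'⟩
      rw [show stopped st B (W (N - n)) n π = W (N - n) (st n π) by simp [stopped, h]]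
      refine (hstep n hn π hn').trans (add_le_add_left (lintegral_mono fun x => hle _ _) _)
  refine (hle 0 π₀).trans ((le_lmarginalPartialTraj_of_le_step (Ψ := fun n =>
    stopped st B (W (N - n)) n) π₀ (fun n => measurable_stopped hst hB (hW _) n) hs le_rfl).trans
    (add_le_add_left ?_ _))
  rw [← lintegral_traj_eq_lmarginalPartialTraj π₀ (measurable_stopped hst hB (hW _) N)
    (dependsOn_stopped hdep _ N), ← iUnion_reachedBy]
  refine le_trans ?_ (measure_mono (Set.subset_iUnion _ N))
  -- At index `N` no move remains and `W 0` vanishes off `B`, so the stopped function is bounded by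
  -- the indicator of having reached `B`.
  rw [← lintegral_indicator_one (measurableSet_reachedBy hst hB N)]
  refine lintegral_mono fun π => ?_
  by_cases h : π ∈ reachedBy st B N
  · simp [stopped, h]
  · have : st N π ∉ B := fun h' => h ⟨N, le_rfl, h'⟩
    simp [stopped, h, hW0 _ this]

end Trajectory

end MA

namespace MA

/-! ### The exponential distribution -/

section Exponential

/-- The null point 0 is dropped, so that later estimates may assume a strictly positive sojourn
time; at a grid point this moves the tick count strictly forward. -/
lemma lintegral_expMeasure_map_toNNReal (E : ℝ) {f : ℝ≥0 → ℝ≥0∞} (hf : Measurable f) :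
    ∫⁻ t, f t ∂(expMeasure E).map Real.toNNReal =
      ∫⁻ t in Set.Ioi 0, ENNReal.ofReal (E * Real.exp (-(E * t))) * f t.toNNReal := by
  have hm : Measurable fun t : ℝ => f t.toNNReal := hf.comp measurable_real_toNNReal
  have hpdf : Measurable (exponentialPDF E) := (measurable_exponentialPDFReal E).ennreal_ofReal
  rw [lintegral_map hf measurable_real_toNNReal]
  change ∫⁻ t, f t.toNNReal ∂(volume.withDensity (exponentialPDF E)) = _
  rw [lintegral_withDensity_eq_lintegral_mul _ hpdf hm, ← lintegral_indicator measurableSet_Ioi]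
  refine lintegral_congr_ae ?_
  filter_upwards [compl_mem_ae_iff.2 (measure_singleton (0 : ℝ))] with t ht
  rcases lt_or_gt_of_ne ht with h | h
  · simp [exponentialPDF_of_neg h, h.le]
  · simp [exponentialPDF_of_nonneg h.le, Set.indicator, h]

lemma lintegral_Ioi_eq_add_shift (g : ℝ → ℝ≥0∞) {τ : ℝ} (hτ : 0 ≤ τ) :
    ∫⁻ t in Set.Ioi 0, g t = (∫⁻ t in Set.Ioc 0 τ, g t) + ∫⁻ t in Set.Ioi 0, g (τ + t) := by
  rw [← Set.Ioc_union_Ioi_eq_Ioi hτ, lintegral_union measurableSet_Ioi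
    (Set.Ioc_disjoint_Ioi le_rfl), Set.Ioc_union_Ioi_eq_Ioi hτ]
  congr 1
  rw [← lintegral_indicator measurableSet_Ioi, ← lintegral_indicator measurableSet_Ioi,
    ← lintegral_add_left_eq_self _ τ]
  refine lintegral_congr fun t => ?_
  simp [Set.indicator]

/-- The exponential distribution is memoryless. -/
lemma lintegral_exp_eq_add (E : ℝ) {f : ℝ≥0 → ℝ≥0∞} (hf : Measurable f) (τ : ℝ≥0) :
    ∫⁻ t, f t ∂(expMeasure E).map Real.toNNReal =
      (∫⁻ t in Set.Ioc 0 (τ : ℝ), ENNReal.ofReal (E * Real.exp (-(E * t))) * f t.toNNReal) +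
        ENNReal.ofReal (Real.exp (-(E * τ))) *
          ∫⁻ t, f (τ + t) ∂(expMeasure E).map Real.toNNReal := by
  have hf' : Measurable fun t => f (τ + t) := hf.comp (measurable_const_add τ)
  rw [lintegral_expMeasure_map_toNNReal E hf, lintegral_expMeasure_map_toNNReal E hf',
    lintegral_Ioi_eq_add_shift _ τ.coe_nonneg, ← lintegral_const_mul']
  · congr 1
    refine setLIntegral_congr_fun measurableSet_Ioi fun t ht => ?_
    have h0 : (0 : ℝ) ≤ t := le_of_lt ht
    have h1 : ((τ : ℝ) + t).toNNReal = τ + t.toNNReal := by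
      rw [Real.toNNReal_add τ.coe_nonneg h0, Real.toNNReal_coe]
    rw [← mul_assoc, ← ENNReal.ofReal_mul (Real.exp_pos _).le]
    congr 2
    · rw [mul_add, neg_add, Real.exp_add]; ring
  · exact ENNReal.ofReal_ne_top

lemma lintegral_Ioc_exp {E : ℝ} (hE : 0 < E) {τ : ℝ} (hτ : 0 ≤ τ) :
    ∫⁻ t in Set.Ioc 0 τ, ENNReal.ofReal (E * Real.exp (-(E * t))) =
      ENNReal.ofReal (1 - Real.exp (-(E * τ))) := by
  have h := lintegral_exponentialPDF_eq_antiDeriv hE τ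
  rw [if_pos hτ, lintegral_Iic_eq_lintegral_Iio_add_Icc _ hτ,
    lintegral_exponentialPDF_of_nonpos le_rfl, zero_add,
    ← setLIntegral_congr Ioc_ae_eq_Icc] at h
  rw [← h]
  exact setLIntegral_congr_fun measurableSet_Ioc fun t ht => (exponentialPDF_of_nonneg ht.1.le).symm

/-- The probability that the first of two consecutive sojourns, with rates `E` and `l`, ends
before time `d` and the second one does not. -/
def oneJump (E l d : ℝ) : ℝ :=
  ∫ t in (0 : ℝ)..d, E * Real.exp (-(E * t)) * Real.exp (-(l * (d - t)))

lemma lintegral_Ioc_oneJump {E : ℝ} (hE : 0 ≤ E) (l : ℝ) {d : ℝ} (hd : 0 ≤ d) :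
    ∫⁻ t in Set.Ioc 0 d, ENNReal.ofReal (E * Real.exp (-(E * t)) * Real.exp (-(l * (d - t)))) =
      ENNReal.ofReal (oneJump E l d) := by
  rw [oneJump, intervalIntegral.integral_of_le hd, ofReal_integral_eq_lintegral_ofReal]
  · exact (Continuous.integrableOn_Icc (by fun_prop)).mono_set Set.Ioc_subset_Icc_self
  · exact .of_forall fun t => by positivity

lemma oneJump_nonneg {E : ℝ} (hE : 0 ≤ E) (l : ℝ) {d : ℝ} (hd : 0 ≤ d) : 0 ≤ oneJump E l d :=
  intervalIntegral.integral_nonneg hd fun t _ => by positivity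

/-- Dropping the factor for the second sojourn, which is at most 1, leaves the probability that the
first one ends before `d`. -/
lemma oneJump_le {E l : ℝ} (hE : 0 < E) (hl : 0 ≤ l) {d : ℝ} (hd : 0 ≤ d) :
    oneJump E l d ≤ 1 - Real.exp (-(E * d)) := by
  have h : 0 ≤ 1 - Real.exp (-(E * d)) := by
    rw [sub_nonneg, Real.exp_le_one_iff]; nlinarith
  rw [← ENNReal.ofReal_le_ofReal_iff h, ← lintegral_Ioc_oneJump hE.le l hd,
    ← lintegral_Ioc_exp hE hd]
  refine setLIntegral_mono' measurableSet_Ioc fun t ht => ENNReal.ofReal_le_ofReal ?_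
  refine mul_le_of_le_one_right (by positivity) ?_
  rw [Real.exp_le_one_iff, neg_nonpos]
  exact mul_nonneg hl (sub_nonneg.2 ht.2)

/-- With `g t = e^{-Et} e^{-l(d-t)}` one has `g' = (l - E) g`, so the right side equals `e^{-ld} + l
∫ g`; since `E ≤ l`, the integrand is at least `e^{-ld}`. Slowing the first clock only makes two
jumps less likely. -/
lemma le_oneJump_add {E l : ℝ} (hl : 0 ≤ l) (hEl : E ≤ l) {d : ℝ} (hd : 0 ≤ d) :
    Real.exp (-(l * d)) * (1 + l * d) ≤ oneJump E l d + Real.exp (-(E * d)) := by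
  set g : ℝ → ℝ := fun t => Real.exp (-(E * t)) * Real.exp (-(l * (d - t))) with hg
  have hder : ∀ t, HasDerivAt g ((l - E) * g t) t := by
    intro t
    have h1 : HasDerivAt (fun t => -(E * t)) (-E) t := by
      simpa using ((hasDerivAt_id t).const_mul E).fun_neg
    have h2 : HasDerivAt (fun t => -(l * (d - t))) l t := by
      simpa using (((hasDerivAt_id t).const_sub d).const_mul l).fun_neg
    convert! h1.exp.mul h2.exp using 1
    simp only [hg]; ring
  have hgc : Continuous g := by fun_prop
  have hint : ∫ t in (0 : ℝ)..d, (l - E) * g t = g d - g 0 :=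
    intervalIntegral.integral_eq_sub_of_hasDerivAt (fun t _ => hder t)
      ((hgc.const_mul _).intervalIntegrable _ _)
  have hge : d * Real.exp (-(l * d)) ≤ ∫ t in (0 : ℝ)..d, g t := by
    have : ∫ _ in (0 : ℝ)..d, Real.exp (-(l * d)) = d * Real.exp (-(l * d)) := by simp
    rw [← this]
    refine intervalIntegral.integral_mono_on hd (by simp) (hgc.intervalIntegrable _ _) fun t ht => ?_
    rw [hg]
    simp only
    rw [← Real.exp_add, Real.exp_le_exp]
    nlinarith [ht.1]
  have hone : oneJump E l d = E * ∫ t in (0 : ℝ)..d, g t := by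
    rw [oneJump, ← intervalIntegral.integral_const_mul]
    congr 1; funext t; simp only [hg]; ring
  rw [intervalIntegral.integral_const_mul] at hint
  have hd' : g d = Real.exp (-(E * d)) := by simp [hg]
  have h0' : g 0 = Real.exp (-(l * d)) := by simp [hg]
  rw [hd', h0'] at hint
  rw [hone]
  nlinarith [mul_le_mul_of_nonneg_left hge hl]

end Exponential

end MA

/-! ### Finite histories and expected values after a move -/

namespace MA

/-- The path that follows `h` and then stays at its last entry. -/
def Hist.extend {X : Type*} {n : ℕ} (h : Hist X n) (i : ℕ) : X :=
  h ⟨min i n, Finset.mem_Iic.2 (min_le_right i n)⟩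

lemma Hist.measurable_extend {X : Type*} [MeasurableSpace X] {n : ℕ} :
    Measurable (Hist.extend : Hist X n → ℕ → X) :=
  measurable_pi_lambda _ fun _ => measurable_pi_apply (X := fun _ : Finset.Iic n => X) _

lemma Hist.extend_frestrictLe {X : Type*} (π : ℕ → X) {i n : ℕ} (h : i ≤ n) :
    Hist.extend (Preorder.frestrictLe (π := fun _ => X) n π) i = π i := by
  simp [Hist.extend, h]

lemma Hist.extend_last {X : Type*} {n : ℕ} (h : Hist X n) : h.extend n = h.last :=
  congrArg h (Subtype.ext (min_self n))

/-- Spreads an error budget over `m` moves; dividing by `m + 1` covers `m = 0`. -/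
lemma exists_ne_zero_natCast_mul_le (m : ℕ) {ε : ℝ≥0∞} (hε : ε ≠ 0) :
    ∃ ε' : ℝ≥0∞, ε' ≠ 0 ∧ m * ε' ≤ ε := by
  have hm : (m + 1 : ℝ≥0∞) ≠ ∞ := by exact_mod_cast ENNReal.natCast_ne_top (m + 1)
  refine ⟨ε / (m + 1), (ENNReal.div_pos hε hm).ne', ?_⟩
  calc (m : ℝ≥0∞) * (ε / (m + 1)) ≤ (m + 1) * (ε / (m + 1)) := by gcongr; exact le_self_add
    _ = ε := ENNReal.mul_div_cancel (by simp) hm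

lemma lintegral_sampleKernel {S : Type*} [Fintype S] [MeasurableSpace S]
    [DiscreteMeasurableSpace S] (μ : Distr S) (f : S → ℝ≥0∞) :
    ∫⁻ s, f s ∂sampleKernel S μ = ∑ s, ENNReal.ofReal (μ.1 s) * f s := by
  change ∫⁻ s, f s ∂(∑ s : S, ENNReal.ofReal (μ.1 s) • Measure.dirac s) = _
  simp [lintegral_finsetSum_measure, lintegral_smul_measure, lintegral_dirac]

lemma sum_ofReal_distr {S : Type*} [Fintype S] (μ : Distr S) :
    ∑ s, ENNReal.ofReal (μ.1 s) = 1 := by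
  rw [← ENNReal.ofReal_sum_of_nonneg (fun s _ => μ.2.1 s), μ.2.2, ENNReal.ofReal_one]

/-- The number of digitisation steps taken by a move. -/
def Move.cost {A : Type*} : Move A → ℕ
  | act _ => 0
  | bot => 1

/-- The expected value of `f` after a move, when `c` digitisation steps have been taken before. -/
def gain {S A : Type*} [Fintype S] (f : S × ℕ → ℝ≥0∞) (c : ℕ) (x : Move A × Distr S) : ℝ≥0∞ :=
  ∑ s, ENNReal.ofReal (x.2.1 s) * f (s, c + x.1.cost)

lemma gain_mono {S A : Type*} [Fintype S] {f g : S × ℕ → ℝ≥0∞} {c d : ℕ}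
    (h : ∀ s i, f (s, c + i) ≤ g (s, d + i)) (x : Move A × Distr S) : gain f c x ≤ gain g d x :=
  Finset.sum_le_sum fun s _ => by gcongr; exact h s _

/-- The pairs of a state in `G` and a number of digitisation steps not exceeding `k`. -/
def stepTarget {S : Type*} (G : Set S) (k : ℕ) : Set (S × ℕ) := {y | y.1 ∈ G ∧ y.2 ≤ k}

end MA

/-! ### Bellman iteration for the digitised automaton -/

namespace DigitisedMA

open MA

variable {S : Type*} {A : Type*} [Fintype S] (N : DigitisedMA S A) (G : Set S) (k : ℕ)

lemma exists_enabled (s : S) : ∃ x, N.Enabled s x := by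
  by_cases h : ∃ a ν, N.it s a ν
  · obtain ⟨a, ν, h⟩ := h
    exact ⟨(.act a, ν), h⟩
  · by_cases h' : ∃ ν, N.mt s ν
    · obtain ⟨ν, h'⟩ := h'
      exact ⟨(.bot, ν), h, .inl h'⟩
    · exact ⟨(.bot, Distr.dirac s), h, .inr ⟨h', rfl⟩⟩

open scoped Classical in
/-- The optimal value of reaching `G` within `n` moves and `k` digitisation steps, as a function
of the state and the number of digitisation steps already taken. -/
def val : ℕ → S × ℕ → ℝ≥0∞
  | 0, y => if y ∈ stepTarget G k then 1 else 0
  | n + 1, y => if y ∈ stepTarget G k then 1 else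
      ⨆ x, ⨆ _ : N.Enabled y.1 x, gain (val n) y.2 x

lemma val_of_mem (n : ℕ) {y : S × ℕ} (h : y ∈ stepTarget G k) : N.val G k n y = 1 := by
  cases n <;> simp [val, h]

lemma val_zero_of_notMem {y : S × ℕ} (h : y ∉ stepTarget G k) : N.val G k 0 y = 0 := by
  simp [val, h]

lemma val_succ_of_notMem (n : ℕ) {y : S × ℕ} (h : y ∉ stepTarget G k) :
    N.val G k (n + 1) y = ⨆ x, ⨆ _ : N.Enabled y.1 x, gain (N.val G k n) y.2 x := by
  simp [val, h]

lemma val_le_one (n : ℕ) (y : S × ℕ) : N.val G k n y ≤ 1 := by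
  by_cases h : y ∈ stepTarget G k
  · rw [val_of_mem N G k n h]
  · induction n generalizing y with
    | zero => simp [val, h]
    | succ n ih =>
      rw [val_succ_of_notMem N G k n h]
      refine iSup₂_le fun x _ => ?_
      rw [gain, ← sum_ofReal_distr x.2]
      refine Finset.sum_le_sum fun s _ => mul_le_of_le_one_right zero_le ?_
      by_cases h' : (s, y.2 + x.1.cost) ∈ stepTarget G k
      · rw [val_of_mem N G k n h']
      · exact ih _ h'

lemma val_le_succ (n : ℕ) (y : S × ℕ) : N.val G k n y ≤ N.val G k (n + 1) y := by
  by_cases h : y ∈ stepTarget G k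
  · rw [val_of_mem N G k _ h, val_of_mem N G k _ h]
  · induction n generalizing y with
    | zero => simp [val_zero_of_notMem N G k h]
    | succ n ih =>
      rw [val_succ_of_notMem N G k n h, val_succ_of_notMem N G k _ h]
      refine iSup₂_mono fun x _ => gain_mono (fun s i => ?_) x
      by_cases h' : (s, y.2 + i) ∈ stepTarget G k
      · rw [val_of_mem N G k _ h', val_of_mem N G k _ h']
      · exact ih _ h'

lemma val_mono : Monotone (N.val G k) := monotone_nat_of_le_succ fun n y => N.val_le_succ G k n y

/-- Fewer steps used means that every continuation meets the step bound more easily. This is what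
makes overcharging a jump harmless in the lower bound. -/
lemma val_antitone (n : ℕ) (s : S) {c d : ℕ} (hcd : c ≤ d) :
    N.val G k n (s, d) ≤ N.val G k n (s, c) := by
  by_cases hc : (s, c) ∈ stepTarget G k
  · rw [val_of_mem N G k n hc]; exact N.val_le_one G k n _
  have hd : (s, d) ∉ stepTarget G k := fun h => hc ⟨h.1, hcd.trans h.2⟩
  induction n generalizing s c d with
  | zero => simp [val_zero_of_notMem N G k hd]
  | succ n ih =>
    rw [val_succ_of_notMem N G k n hc, val_succ_of_notMem N G k n hd]
    refine iSup₂_mono fun x _ => gain_mono (fun s' i => ?_) x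
    have hi : c + i ≤ d + i := by omega
    by_cases hc' : (s', c + i) ∈ stepTarget G k
    · rw [val_of_mem N G k n hc']; exact N.val_le_one G k n _
    · exact ih s' hi hc' fun h => hc' ⟨h.1, hi.trans h.2⟩

/-- Step counts never decrease, so beyond `k` the target is out of reach. -/
lemma val_eq_zero_of_lt (n : ℕ) (s : S) {c : ℕ} (hc : k < c) : N.val G k n (s, c) = 0 := by
  have h : ∀ s c, k < c → (s, c) ∉ stepTarget G k := fun s c hc h => absurd h.2 (by simpa using hc)
  induction n generalizing s c with
  | zero => exact val_zero_of_notMem N G k (h s c hc)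
  | succ n ih =>
    rw [val_succ_of_notMem N G k n (h s c hc)]
    simp only [ENNReal.iSup_eq_zero, gain]
    intro x _
    exact Finset.sum_eq_zero fun s' _ => by rw [ih s' (by omega), mul_zero]

/-- The optimal value of reaching `G` within `k` digitisation steps, as a function of the state
and the number of digitisation steps already taken. -/
def value (y : S × ℕ) : ℝ≥0∞ := ⨆ n, N.val G k n y

lemma value_of_mem {y : S × ℕ} (h : y ∈ stepTarget G k) : N.value G k y = 1 := by
  simp [value, val_of_mem N G k _ h]

lemma value_le_one (y : S × ℕ) : N.value G k y ≤ 1 := iSup_le fun n => N.val_le_one G k n y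

lemma gain_value (c : ℕ) (x : Move A × Distr S) :
    gain (N.value G k) c x = ⨆ n, gain (N.val G k n) c x := by
  simp only [gain, value, ENNReal.mul_iSup]
  exact ENNReal.finsetSum_iSup_of_monotone fun s m n h => by gcongr; exact N.val_mono G k h _

/-- Each enabled move is one candidate in the Bellman recursion with one more move; monotone
convergence passes to the limit. Thus `value` is excessive. -/
lemma gain_value_le {y : S × ℕ} (h : y ∉ stepTarget G k) {x : Move A × Distr S}
    (hx : N.Enabled y.1 x) : gain (N.value G k) y.2 x ≤ N.value G k y := by
  rw [gain_value]
  refine iSup_le fun n => le_trans ?_ (le_iSup (fun n => N.val G k n y) (n + 1))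
  rw [val_succ_of_notMem N G k n h]
  exact le_iSup₂ (f := fun x (_ : N.Enabled y.1 x) => gain (N.val G k n) y.2 x) x hx

/-- The supremum need not be attained, since a state may have infinitely many enabled transitions.
On the target only the existence of an enabled move matters, to have a policy defined everywhere. -/
lemma exists_val_le_gain_add (n : ℕ) (y : S × ℕ) {ε : ℝ≥0∞} (hε : ε ≠ 0) :
    ∃ x, N.Enabled y.1 x ∧
      (y ∉ stepTarget G k → N.val G k (n + 1) y ≤ gain (N.val G k n) y.2 x + ε) := by
  by_cases h : y ∈ stepTarget G k
  · obtain ⟨x, hx⟩ := N.exists_enabled y.1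
    exact ⟨x, hx, fun h' => absurd h h'⟩
  -- Subtracting `ε` gives a strictly smaller number only if the value is nonzero.
  by_cases h0 : N.val G k (n + 1) y = 0
  · obtain ⟨x, hx⟩ := N.exists_enabled y.1
    exact ⟨x, hx, fun _ => by simp [h0]⟩
  have hlt : N.val G k (n + 1) y - ε < N.val G k (n + 1) y :=
    ENNReal.sub_lt_self ((N.val_le_one G k _ y).trans_lt ENNReal.one_lt_top).ne h0 hε
  nth_rw 2 [val_succ_of_notMem N G k n h] at hlt
  obtain ⟨x, hx⟩ := lt_iSup_iff.1 hlt
  obtain ⟨hen, hx⟩ := lt_iSup_iff.1 hx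
  exact ⟨x, hen, fun _ => tsub_le_iff_right.1 hx.le⟩

/-- A move that is optimal up to `ε` for the remaining `n + 1` moves. -/
def selector {ε : ℝ≥0∞} (hε : ε ≠ 0) (n : ℕ) (y : S × ℕ) : Move A × Distr S :=
  (N.exists_val_le_gain_add G k n y hε).choose

lemma selector_enabled {ε : ℝ≥0∞} (hε : ε ≠ 0) (n : ℕ) (y : S × ℕ) :
    N.Enabled y.1 (N.selector G k hε n y) :=
  (N.exists_val_le_gain_add G k n y hε).choose_spec.1

lemma val_le_gain_selector_add {ε : ℝ≥0∞} (hε : ε ≠ 0) (n : ℕ) {y : S × ℕ}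
    (h : y ∉ stepTarget G k) :
    N.val G k (n + 1) y ≤ gain (N.val G k n) y.2 (N.selector G k hε n y) + ε :=
  (N.exists_val_le_gain_add G k n y hε).choose_spec.2 h

/-- The state and the number of digitisation steps taken when the `i`-th state is entered. -/
def status (i : ℕ) (π : ℕ → Entry S A) : S × ℕ := ((π i).2, stepCount π i)

lemma stepCount_eq_sum (π : ℕ → Entry S A) (i : ℕ) :
    stepCount π i = ∑ j ∈ Finset.range i, (π (j + 1)).1.1.cost := by
  classical
  rw [stepCount, Finset.card_filter]
  refine Finset.sum_congr rfl fun j _ => ?_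
  cases h : (π (j + 1)).1.1 <;> simp [Move.cost]

lemma dependsOn_status (i : ℕ) : DependsOn (status (S := S) (A := A) i) (Set.Iic i) := by
  intro π π' h
  simp only [status, stepCount_eq_sum]
  congr 1
  · rw [h i (Set.mem_Iic.2 le_rfl)]
  · exact Finset.sum_congr rfl fun j hj => by
      rw [h (j + 1) (Set.mem_Iic.2 (Finset.mem_range.1 hj))]

lemma status_update (i : ℕ) (π : ℕ → Entry S A) (x : Entry S A) :
    status (i + 1) (Function.update π (i + 1) x) = (x.2, stepCount π i + x.1.1.cost) := by
  simp only [status, stepCount_eq_sum, Finset.sum_range_succ, Function.update_self]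
  congr 2
  exact Finset.sum_congr rfl fun j hj => by
    rw [Function.update_of_ne]
    have := Finset.mem_range.1 hj
    omega

lemma measurable_gain (f : S × ℕ → ℝ≥0∞) (c : ℕ) :
    Measurable (gain f c : Move A × Distr S → ℝ≥0∞) := by
  refine Finset.measurable_sum _ fun s _ => Measurable.mul ?_ ?_
  · exact ENNReal.measurable_ofReal.comp
      ((measurable_pi_apply s).comp (measurable_subtype_coe.comp measurable_snd))
  · exact (Measurable.of_discrete (f := fun m : Move A => f (s, c + m.cost))).comp measurable_fst

variable [MeasurableSpace S]

lemma measurable_status [Finite A] (i : ℕ) : Measurable (status (S := S) (A := A) i) := by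
  refine Measurable.prodMk (by fun_prop) ?_
  simp only [stepCount_eq_sum]
  refine Finset.measurable_sum _ fun j _ => ?_
  exact (Measurable.of_discrete (f := Move.cost)).comp
    (measurable_fst.comp (measurable_fst.comp (measurable_pi_apply (j + 1))))

variable [DiscreteMeasurableSpace S] [Finite A] {N G k}

lemma Policy.nextLIntegral_step (D : N.Policy) (f : S × ℕ → ℝ≥0∞) (n : ℕ)
    (π : ℕ → Entry S A) :
    nextLIntegral D.step n (fun π' => f (status (n + 1) π')) π =
      ∫⁻ x, gain f (stepCount π n) x
        ∂D.choice n (Preorder.frestrictLe (π := fun _ => Entry S A) n π) := by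
  simp only [nextLIntegral, status_update, Policy.step]
  have hf : Measurable fun x : Entry S A => f (x.2, stepCount π n + x.1.1.cost) :=
    (Measurable.of_discrete (f := fun z : S × Move A => f (z.1, stepCount π n + z.2.cost))).comp
      (measurable_snd.prodMk (measurable_fst.comp measurable_fst))
  rw [Kernel.lintegral_compProd _ _ _ hf]
  refine lintegral_congr fun x => ?_
  rw [Kernel.comap_apply]
  exact lintegral_sampleKernel x.2 _

/-- The policy averages over enabled moves only, and `value` is excessive for each of them, whatever
the history. -/
lemma Policy.measure_stepReach_le (D : N.Policy) (s : S) :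
    D.pathMeasure s (stepReach G k) ≤ N.value G k (s, 0) := by
  refine traj_reach_le (κ := D.step) (st := status) (B := stepTarget G k) (W := N.value G k)
    (fun _ => ((Move.bot, Distr.dirac s), s)) measurable_status dependsOn_status .of_discrete
    .of_discrete (fun y hy => (N.value_of_mem G k hy).ge) fun n π h => ?_
  rw [D.nextLIntegral_step]
  have hen := D.enabled n (Preorder.frestrictLe (π := fun _ => Entry S A) n π)
  have hle : ∀ᵐ x ∂D.choice n (Preorder.frestrictLe (π := fun _ => Entry S A) n π),
      gain (N.value G k) (stepCount π n) x ≤ N.value G k (status n π) := by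
    filter_upwards [hen] with x hx using N.gain_value_le G k h hx
  exact (lintegral_mono_ae hle).trans (by simp)

lemma pMax_le_value (s : S) : N.pMax s G k ≤ (N.value G k (s, 0)).toReal := by
  refine Real.iSup_le (fun D => ?_) ENNReal.toReal_nonneg
  exact ENNReal.toReal_mono ((N.value_le_one G k _).trans_lt ENNReal.one_lt_top).ne
    (D.measure_stepReach_le s)

variable (N G k) in
/-- The policy that plays, for `m` moves, moves that are optimal up to `ε`. -/
def selectorPolicy {ε : ℝ≥0∞} (hε : ε ≠ 0) (m : ℕ) : N.Policy where
  -- At index `n` there remain `m - n` moves, and `selector` with parameter `j` serves `j + 1` of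
  -- them. After `m` moves the truncated difference is 0 and the choice is merely enabled.
  choice n := Kernel.deterministic
    (fun h => N.selector G k hε (m - (n + 1)) (status n h.extend))
    ((Measurable.of_discrete (f := N.selector G k hε (m - (n + 1)))).comp
      ((measurable_status n).comp Hist.measurable_extend))
  markov n := inferInstance
  enabled n h := by
    rw [Kernel.deterministic_apply, ae_dirac_eq]
    have := N.selector_enabled G k hε (m - (n + 1)) (status n h.extend)
    rwa [show (status n h.extend).1 = h.last.2 from congrArg Prod.snd h.extend_last] at this

/-- For each horizon `m`, `selectorPolicy` loses at most `ε'` in each of its first `m` moves, hence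
at most `ε` in all. -/
lemma value_le_pMax (s : S) : N.value G k (s, 0) ≤ ENNReal.ofReal (N.pMax s G k) := by
  refine iSup_le fun m => ENNReal.le_of_forall_pos_le_add fun ε hε _ => ?_
  obtain ⟨ε', hε0, hmε⟩ := exists_ne_zero_natCast_mul_le m (ENNReal.coe_ne_zero.2 hε.ne')
  set D := N.selectorPolicy G k hε0 m with hD
  have key := le_traj_reach (κ := D.step) (st := status) (B := stepTarget G k)
    (W := N.val G k) (ε := ε') (N := m)
    (fun _ => ((Move.bot, Distr.dirac s), s)) measurable_status dependsOn_status .of_discrete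
    (fun _ => .of_discrete) (N.val_le_one G k) (fun y hy => N.val_zero_of_notMem G k hy)
    fun n hn π h => by
      rw [D.nextLIntegral_step, hD]
      simp only [selectorPolicy]
      rw [Kernel.lintegral_deterministic' _ (measurable_gain _ _)]
      have hst : status n (Hist.extend (Preorder.frestrictLe (π := fun _ => Entry S A) n π)) =
          status n π := dependsOn_status n fun i hi => Hist.extend_frestrictLe π hi
      rw [hst, show m - n = m - (n + 1) + 1 by omega]
      exact N.val_le_gain_selector_add G k hε0 _ h
  refine key.trans (add_le_add ?_ hmε)
  change D.pathMeasure s (stepReach G k) ≤ _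
  rw [← ofReal_measureReal]
  refine ENNReal.ofReal_le_ofReal (le_ciSup (f := fun D : N.Policy =>
    (D.pathMeasure s).real (stepReach G k)) ⟨1, ?_⟩ D)
  rintro _ ⟨D', rfl⟩
  exact measureReal_le_one

end DigitisedMA

/-! ### Converting time into digitisation steps -/

namespace MA

/-- The number of digitisation steps of length `δ` that have been started by time `T`. -/
def ticks (δ : ℝ) (T : ℝ≥0) : ℕ := ⌈(T : ℝ) / δ⌉₊

lemma ticks_zero (δ : ℝ) : ticks δ 0 = 0 := by simp [ticks]

lemma measurable_ticks (δ : ℝ) : Measurable (ticks δ) :=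
  Nat.measurable_ceil.comp (measurable_coe_nnreal_real.div_const δ)

variable {δ : ℝ}

lemma ticks_le_iff (hδ : 0 < δ) {T : ℝ≥0} {k : ℕ} : ticks δ T ≤ k ↔ (T : ℝ) ≤ k * δ := by
  rw [ticks, Nat.ceil_le, div_le_iff₀ hδ]

lemma le_ticks_mul (hδ : 0 < δ) (T : ℝ≥0) : (T : ℝ) ≤ ticks δ T * δ := (ticks_le_iff hδ).1 le_rfl

lemma ticks_mono (hδ : 0 < δ) : Monotone (ticks δ) := fun T U h =>
  Nat.ceil_mono (div_le_div_of_nonneg_right (by exact_mod_cast h) hδ.le)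

lemma ticks_add_le (hδ : 0 < δ) (T : ℝ≥0) {t : ℝ≥0} (ht : (t : ℝ) ≤ δ) :
    ticks δ (T + t) ≤ ticks δ T + 1 := by
  rw [ticks_le_iff hδ]
  push_cast
  linarith [le_ticks_mul hδ T]

lemma ticks_nat_mul_add (hδ : 0 < δ) {T : ℝ≥0} {c : ℕ} (hT : (T : ℝ) = c * δ) {t : ℝ≥0}
    (ht0 : 0 < t) (ht : (t : ℝ) ≤ δ) : ticks δ (T + t) = c + 1 := by
  refine le_antisymm ?_ (Nat.succ_le_of_lt (not_le.1 fun h => ?_))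
  · rw [ticks_le_iff hδ]; push_cast; linarith
  · rw [ticks_le_iff hδ] at h; push_cast at h
    have : (0 : ℝ) < t := ht0
    linarith

/-- The pairs of a state in `G` and a time not exceeding `b`. -/
def timedTarget {S : Type*} (G : Set S) (b : ℝ) : Set (S × ℝ≥0) := {y | y.1 ∈ G ∧ (y.2 : ℝ) ≤ b}

/-- Rounding up is what makes the two targets agree exactly when the time bound is a multiple of
`δ`. -/
lemma mem_timedTarget_iff {S : Type*} {G : Set S} (hδ : 0 < δ) {k : ℕ} {y : S × ℝ≥0} :
    y ∈ timedTarget G (k * δ) ↔ (y.1, ticks δ y.2) ∈ stepTarget G k :=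
  and_congr_right fun _ => (ticks_le_iff hδ).symm

lemma measurableSet_timedTarget {S : Type*} [MeasurableSpace S] [DiscreteMeasurableSpace S]
    (G : Set S) (b : ℝ) : MeasurableSet (timedTarget G b) :=
  (MeasurableSet.of_discrete.preimage measurable_fst).inter
    (measurableSet_le (measurable_coe_nnreal_real.comp measurable_snd) measurable_const)

end MA

/-! ### One-move expectations for timed paths -/

namespace MarkovAutomaton

open MA

variable {S : Type*} {A : Type*} [Fintype S] (M : MarkovAutomaton S A)

/-- The expected value of `f` after a move that is chosen in state `s` at time `T`. -/
def timedGain (f : S × ℝ≥0 → ℝ≥0∞) (s : S) (T : ℝ≥0) (x : Move A × Distr S) : ℝ≥0∞ :=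
  ∫⁻ t, ∑ s', ENNReal.ofReal (x.2.1 s') * f (s', T + t) ∂M.sojourn s x.1

/-- The state and the time when the `i`-th state is entered. -/
def timedStatus (i : ℕ) (π : ℕ → TimedEntry S A) : S × ℝ≥0 := ((π i).1.2, entryTime π i)

lemma dependsOn_timedStatus (i : ℕ) :
    DependsOn (timedStatus (S := S) (A := A) i) (Set.Iic i) := by
  intro π π' h
  simp only [timedStatus, entryTime]
  congr 1
  · rw [h i (Set.mem_Iic.2 le_rfl)]
  · exact Finset.sum_congr rfl fun j hj => by
      rw [h (j + 1) (Set.mem_Iic.2 (Finset.mem_range.1 hj))]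

lemma timedStatus_update (i : ℕ) (π : ℕ → TimedEntry S A) (x : TimedEntry S A) :
    timedStatus (i + 1) (Function.update π (i + 1) x) = (x.1.2, entryTime π i + x.2) := by
  simp only [timedStatus, entryTime, Finset.sum_range_succ, Function.update_self]
  congr 2
  exact Finset.sum_congr rfl fun j hj => by
    rw [Function.update_of_ne]
    have := Finset.mem_range.1 hj
    omega

variable [MeasurableSpace S]

lemma measurable_timedStatus (i : ℕ) : Measurable (timedStatus (S := S) (A := A) i) := by
  refine Measurable.prodMk (by fun_prop) ?_
  exact Finset.measurable_sum _ fun j _ =>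
    measurable_snd.comp (measurable_pi_apply (j + 1))

variable {M}

lemma measurable_sum_ofReal_mul {f : S × ℝ≥0 → ℝ≥0∞} (hf : Measurable f) (μ : Distr S)
    (T : ℝ≥0) : Measurable fun t => ∑ s', ENNReal.ofReal (μ.1 s') * f (s', T + t) :=
  Finset.measurable_sum _ fun _ _ =>
    (hf.comp (measurable_const.prodMk (measurable_const_add T))).const_mul _

lemma timedGain_eq {f : S × ℝ≥0 → ℝ≥0∞} (hf : Measurable f) (s : S) (T : ℝ≥0)
    (x : Move A × Distr S) :
    M.timedGain f s T x =
      ∑ s', ENNReal.ofReal (x.2.1 s') * ∫⁻ t, f (s', T + t) ∂M.sojourn s x.1 := by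
  have hf' : ∀ s', Measurable fun t => f (s', T + t) := fun s' =>
    hf.comp (measurable_const.prodMk (measurable_const_add T))
  rw [timedGain, lintegral_finsetSum _ fun s' _ => (hf' s').const_mul _]
  exact Finset.sum_congr rfl fun s' _ => lintegral_const_mul _ (hf' s')

lemma measurable_timedGain {f : S × ℝ≥0 → ℝ≥0∞} (hf : Measurable f) (s : S) (T : ℝ≥0) :
    Measurable (M.timedGain f s T) := by
  rw [show M.timedGain f s T = _ from funext fun x => timedGain_eq hf s T x]
  refine Finset.measurable_sum _ fun s' _ => Measurable.mul ?_ ?_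
  · exact ENNReal.measurable_ofReal.comp
      ((measurable_pi_apply s').comp (measurable_subtype_coe.comp measurable_snd))
  · exact (Measurable.of_discrete (f := fun m : Move A =>
      ∫⁻ t, f (s', T + t) ∂M.sojourn s m)).comp measurable_fst

variable [DiscreteMeasurableSpace S] [Finite A]

lemma Policy.nextLIntegral_step (D : M.Policy) {f : S × ℝ≥0 → ℝ≥0∞} (hf : Measurable f) (n : ℕ)
    (π : ℕ → TimedEntry S A) :
    nextLIntegral D.step n (fun π' => f (timedStatus (n + 1) π')) π =
      ∫⁻ x, M.timedGain f (π n).1.2 (entryTime π n) x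
        ∂D.choice n (Preorder.frestrictLe (π := fun _ => TimedEntry S A) n π) := by
  simp only [nextLIntegral, timedStatus_update, Policy.step]
  have h1 : Measurable fun x : TimedEntry S A => f (x.1.2, entryTime π n + x.2) :=
    hf.comp ((measurable_snd.comp measurable_fst).prodMk (measurable_snd.const_add _))
  rw [Kernel.lintegral_compProd _ _ _ h1, Kernel.lintegral_compProd]
  · refine lintegral_congr fun x => ?_
    rw [timedGain_eq hf, Kernel.comap_apply]
    exact lintegral_sampleKernel x.2 _
  · exact (Measurable.of_discrete (f := fun z : S × Move A =>
      ∫⁻ t, f (z.1, entryTime π n + t) ∂M.sojourn (π n).1.2 z.2)).comp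
        (measurable_snd.prodMk (measurable_fst.comp measurable_fst))

end MarkovAutomaton

namespace MarkovAutomaton

open MA

variable {S : Type*} {A : Type*} [Fintype S] (M : MarkovAutomaton S A)

/-! ### The moves of the automaton and of its digitisation -/

lemma maxExitRate_nonneg : 0 ≤ M.maxExitRate := Real.iSup_nonneg fun s => M.exitRate_nonneg s

lemma exitRate_le_max {s : S} (hs : s ∈ M.MS) : M.exitRate s ≤ M.maxExitRate :=
  le_ciSup (f := fun s : M.MS => M.exitRate s) (Set.finite_range _).bddAbove ⟨s, hs⟩

variable {M} {δ : ℝ} (hδ : 0 < δ)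

lemma enabled_digitise_of_mem_PS {s : S} (hs : s ∈ M.PS) {x : Move A × Distr S}
    (hx : (M.digitise δ hδ).Enabled s x) : ∃ a μ, x = (.act a, μ) ∧ M.it s a μ := by
  obtain ⟨_ | _, μ⟩ := x
  · exact ⟨_, _, rfl, hx⟩
  · exact absurd hs hx.1

lemma enabled_of_mem_PS {s : S} (hs : s ∈ M.PS) {x : Move A × Distr S}
    (hx : M.Enabled s x) : ∃ a μ, x = (.act a, μ) ∧ M.it s a μ := by
  obtain ⟨_ | _, μ⟩ := x
  · exact ⟨_, _, rfl, hx⟩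
  · exact absurd hs hx.1

lemma enabled_of_notMem_PS {s : S} (hs : s ∉ M.PS) {x : Move A × Distr S}
    (hx : M.Enabled s x) : x = (.bot, M.jump s) := by
  obtain ⟨_ | _, μ⟩ := x
  · exact absurd ⟨_, _, hx⟩ hs
  · rw [hx.2]

lemma enabled_digitise_of_mem_MS {s : S} (hs : s ∈ M.MS) {x : Move A × Distr S} :
    (M.digitise δ hδ).Enabled s x ↔ x = (.bot, M.digitJump δ hδ s) := by
  constructor
  · intro hx
    obtain ⟨_ | _, μ⟩ := x
    · exact absurd ⟨_, _, hx⟩ hs.1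
    · obtain ⟨-, h | h⟩ := hx
      · rw [h.2]
      · exact absurd ⟨_, hs, rfl⟩ h.1
  · rintro rfl
    exact ⟨hs.1, .inl ⟨hs, rfl⟩⟩

lemma enabled_digitise_of_notMem {s : S} (hs : s ∉ M.PS) (hs' : s ∉ M.MS) {x : Move A × Distr S}
    (hx : (M.digitise δ hδ).Enabled s x) : x = (.bot, Distr.dirac s) := by
  obtain ⟨_ | _, μ⟩ := x
  · exact absurd ⟨_, _, hx⟩ hs
  · obtain ⟨-, h | h⟩ := hx
    · exact absurd h.1 hs'
    · rw [h.2]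

lemma sum_dirac_mul (s : S) (f : S → ℝ≥0∞) :
    ∑ s', ENNReal.ofReal ((Distr.dirac s).1 s') * f s' = f s := by
  classical
  rw [Finset.sum_eq_single s]
  · simp [Distr.dirac]
  · intro s' _ h
    simp [Distr.dirac, h]
  · simp

lemma gain_digitJump (f : S × ℕ → ℝ≥0∞) (c : ℕ) (s : S) :
    gain f c ((.bot, M.digitJump δ hδ s) : Move A × Distr S) =
      ENNReal.ofReal (1 - Real.exp (-(M.exitRate s * δ))) *
          ∑ s', ENNReal.ofReal ((M.jump s).1 s') * f (s', c + 1) +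
        ENNReal.ofReal (Real.exp (-(M.exitRate s * δ))) * f (s, c + 1) := by
  classical
  have h1 : 0 ≤ 1 - Real.exp (-(M.exitRate s * δ)) := by
    rw [sub_nonneg, Real.exp_le_one_iff, neg_nonpos]
    exact mul_nonneg (M.exitRate_nonneg s) hδ.le
  have key : ∀ s', ENNReal.ofReal ((M.digitJump δ hδ s).1 s') =
      ENNReal.ofReal (1 - Real.exp (-(M.exitRate s * δ))) * ENNReal.ofReal ((M.jump s).1 s') +
        ENNReal.ofReal (Real.exp (-(M.exitRate s * δ))) * if s' = s then 1 else 0 := by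
    intro s'
    have hP := (M.jump s).2.1 s'
    by_cases h : s' = s
    · simp only [digitJump, h, ne_eq, not_true_eq_false, if_false, if_true, mul_one]
      rw [ENNReal.ofReal_add (mul_nonneg h1 (h ▸ hP)) (Real.exp_pos _).le, ENNReal.ofReal_mul h1]
    · simp only [digitJump, h, ne_eq, not_false_eq_true, if_true, if_false, mul_zero, add_zero]
      rw [ENNReal.ofReal_mul h1]
  simp only [gain, Move.cost, key, add_mul, Finset.sum_add_distrib, Finset.mul_sum, mul_assoc]
  simp

lemma timedGain_act (f : S × ℝ≥0 → ℝ≥0∞) (s : S) (T : ℝ≥0) (a : A) (μ : Distr S) [MeasurableSpace S]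
    (hf : Measurable f) :
    M.timedGain f s T (.act a, μ) = ∑ s', ENNReal.ofReal (μ.1 s') * f (s', T) := by
  simp only [timedGain, sojourn]
  rw [lintegral_dirac' _ (measurable_sum_ofReal_mul hf μ T)]
  simp

lemma timedGain_idle (f : S × ℝ≥0 → ℝ≥0∞) {s : S} (hs : s ∉ M.MS) (T : ℝ≥0) [MeasurableSpace S]
    (hf : Measurable f) :
    M.timedGain f s T ((.bot, M.jump s) : Move A × Distr S) = f (s, T + 1) := by
  simp only [timedGain, sojourn, if_neg hs]
  rw [lintegral_dirac' _ (measurable_sum_ofReal_mul hf _ T), jump, dif_neg hs,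
    sum_dirac_mul s fun s' => f (s', T + 1)]

lemma timedGain_markov (f : S × ℝ≥0 → ℝ≥0∞) {s : S} (hs : s ∈ M.MS) (T : ℝ≥0) :
    M.timedGain f s T ((.bot, M.jump s) : Move A × Distr S) =
      ∫⁻ t, ∑ s', ENNReal.ofReal ((M.jump s).1 s') * f (s', T + t)
        ∂(expMeasure (M.exitRate s)).map Real.toNNReal := by
  simp only [timedGain, sojourn, if_pos hs]

/-! ### The digitised value is a lower bound -/

section LowerBound

variable (G : Set S) (k : ℕ)

/-- An idle state outside `G` only returns to itself, so a timed policy owes nothing there. -/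
lemma val_idle_eq_zero {s : S} (hs : s ∉ M.PS) (hs' : s ∉ M.MS) (hG : s ∉ G) (n c : ℕ) :
    (M.digitise δ hδ).val G k n (s, c) = 0 := by
  have hB : ∀ c, (s, c) ∉ stepTarget G k := fun c h => hG h.1
  induction n generalizing c with
  | zero => exact DigitisedMA.val_zero_of_notMem _ G k (hB c)
  | succ n ih =>
    rw [DigitisedMA.val_succ_of_notMem _ G k n (hB c)]
    simp only [ENNReal.iSup_eq_zero]
    intro x hx
    rw [enabled_digitise_of_notMem hδ hs hs' hx, gain, sum_dirac_mul s fun s' =>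
      (M.digitise δ hδ).val G k n (s', c + (Move.bot : Move A).cost), ih]

lemma val_succ_of_mem_MS {s : S} (hs : s ∈ M.MS) {c : ℕ} (hB : (s, c) ∉ stepTarget G k) (n : ℕ) :
    (M.digitise δ hδ).val G k (n + 1) (s, c) =
      gain ((M.digitise δ hδ).val G k n) c ((.bot, M.digitJump δ hδ s) : Move A × Distr S) := by
  rw [DigitisedMA.val_succ_of_notMem _ G k n hB]
  simp [enabled_digitise_of_mem_MS hδ hs]

/-- The digitised value at the number of digitisation steps that corresponds to the time. -/
def timedVal (n : ℕ) (y : S × ℝ≥0) : ℝ≥0∞ := (M.digitise δ hδ).val G k n (y.1, ticks δ y.2)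

open scoped Classical in
/-- The move that is chosen in state `s` after `c` digitisation steps if `n + 1` moves remain:
almost optimal in the digitised automaton if the state is probabilistic. -/
def timedSelector {ε : ℝ≥0∞} (hε : ε ≠ 0) (n : ℕ) (y : S × ℕ) : Move A × Distr S :=
  if y.1 ∈ M.PS then (M.digitise δ hδ).selector G k hε n y else (.bot, M.jump y.1)

lemma timedSelector_enabled {ε : ℝ≥0∞} (hε : ε ≠ 0) (n : ℕ) (y : S × ℕ) :
    M.Enabled y.1 (timedSelector (M := M) hδ G k hε n y) := by
  rw [timedSelector]
  split_ifs with h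
  · obtain ⟨a, μ, hx, hit⟩ := enabled_digitise_of_mem_PS hδ h
      ((M.digitise δ hδ).selector_enabled G k hε n y)
    rw [hx]
    exact hit
  · exact ⟨h, rfl⟩

variable [MeasurableSpace S] [DiscreteMeasurableSpace S]

lemma measurable_timedVal (n : ℕ) : Measurable (timedVal (M := M) hδ G k n) :=
  (Measurable.of_discrete (f := (M.digitise δ hδ).val G k n)).comp
    (measurable_fst.prodMk ((measurable_ticks δ).comp measurable_snd))

/-- One timed sojourn corresponds to a run of digitised self-loops ended by a jump. The sojourn is
cut after time `δ`: a jump before that raises the tick count by at most one, and otherwise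
memorylessness restarts the comparison one tick later. -/
lemma timedVal_succ_le_of_mem_MS {s : S} (hs : s ∈ M.MS) (hG : s ∉ G) (n : ℕ) (T : ℝ≥0) :
    timedVal (M := M) hδ G k (n + 1) (s, T) ≤
      M.timedGain (timedVal (M := M) hδ G k n) s T ((.bot, M.jump s) : Move A × Distr S) := by
  set N := M.digitise δ hδ with hN
  rw [timedGain_markov _ hs]
  -- `d` bounds the number of ticks until the count exceeds `k`, where the digitised value vanishes
  -- and the recursion ends.
  obtain ⟨d, hd⟩ : ∃ d, k + 1 ≤ ticks δ T + d := ⟨k + 1, by omega⟩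
  induction d generalizing T with
  | zero =>
    rw [timedVal, N.val_eq_zero_of_lt G k _ _ (show k < ticks δ T by omega)]
    exact bot_le
  | succ d ih =>
    have hτ : ticks δ (T + δ.toNNReal) = ticks δ T + 1 := by
      simp only [ticks, NNReal.coe_add, Real.coe_toNNReal _ hδ.le, add_div, div_self hδ.ne']
      exact Nat.ceil_add_one (by positivity)
    have hB : (s, ticks δ T) ∉ stepTarget G k := fun h => hG h.1
    rw [lintegral_exp_eq_add (M.exitRate s)
      (measurable_sum_ofReal_mul (measurable_timedVal hδ G k n) _ T) δ.toNNReal,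
      timedVal, val_succ_of_mem_MS hδ G k hs hB, gain_digitJump]
    have hδ' : ((δ.toNNReal : ℝ≥0) : ℝ) = δ := Real.coe_toNNReal _ hδ.le
    rw [hδ']
    refine add_le_add ?_ ?_
    · rw [← lintegral_Ioc_exp (M.exitRate_pos hs) hδ.le, ← lintegral_mul_const _ (by fun_prop)]
      refine setLIntegral_mono' measurableSet_Ioc fun t ht => ?_
      gcongr with s'
      exact N.val_antitone G k n s' (ticks_add_le hδ T
        ((Real.coe_toNNReal t ht.1.le).trans_le ht.2))
    · refine mul_le_mul_right ?_ _
      have := ih (T + δ.toNNReal) (by omega)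
      rw [timedVal] at this
      simp only [hτ, add_assoc] at this ⊢
      -- The self-loop used up a digitised move while the timed path has made none, so the horizon
      -- is raised from `n` back to `n + 1` before the induction hypothesis applies.
      exact (N.val_le_succ G k n _).trans this

lemma timedVal_succ_le {ε : ℝ≥0∞} (hε : ε ≠ 0) (n : ℕ) {s : S} {T : ℝ≥0}
    (h : (s, T) ∉ timedTarget G (k * δ)) :
    timedVal (M := M) hδ G k (n + 1) (s, T) ≤
      M.timedGain (timedVal (M := M) hδ G k n) s T
        (timedSelector (M := M) hδ G k hε n (s, ticks δ T)) + ε := by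
  rw [mem_timedTarget_iff hδ] at h
  by_cases hPS : s ∈ M.PS
  · rw [timedSelector, if_pos hPS]
    obtain ⟨a, μ, hx, -⟩ := enabled_digitise_of_mem_PS hδ hPS
      ((M.digitise δ hδ).selector_enabled G k hε n (s, ticks δ T))
    have := (M.digitise δ hδ).val_le_gain_selector_add G k hε n h
    rw [hx] at this ⊢
    rw [timedGain_act _ _ _ _ _ (measurable_timedVal hδ G k n)]
    simpa [gain, Move.cost, timedVal] using this
  by_cases hG : s ∈ G
  · have hk : k < ticks δ T := not_le.1 fun h' => h ⟨hG, h'⟩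
    rw [timedVal, DigitisedMA.val_eq_zero_of_lt _ G k _ _ hk]
    exact bot_le
  refine le_trans ?_ le_self_add
  rw [timedSelector, if_neg hPS]
  by_cases hMS : s ∈ M.MS
  · exact timedVal_succ_le_of_mem_MS hδ G k hMS hG n T
  · rw [timedVal, val_idle_eq_zero hδ G k hPS hMS hG]
    exact bot_le

variable [Finite A]

variable (M) in
/-- The policy that plays, for `m` moves, the moves chosen by `timedSelector`. -/
def timedSelectorPolicy {ε : ℝ≥0∞} (hε : ε ≠ 0) (m : ℕ) : M.Policy where
  choice n := Kernel.deterministic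
    (fun h => timedSelector (M := M) hδ G k hε (m - (n + 1))
      ((timedStatus n h.extend).1, ticks δ (timedStatus n h.extend).2))
    ((Measurable.of_discrete (f := timedSelector (M := M) hδ G k hε (m - (n + 1)))).comp
      ((measurable_fst.prodMk ((measurable_ticks δ).comp measurable_snd)).comp
        ((measurable_timedStatus n).comp Hist.measurable_extend)))
  markov n := inferInstance
  enabled n h := by
    rw [Kernel.deterministic_apply, ae_dirac_eq]
    have := timedSelector_enabled (M := M) hδ G k hε (m - (n + 1))
      ((timedStatus n h.extend).1, ticks δ (timedStatus n h.extend).2)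
    have hl : (timedStatus n h.extend).1 = h.last.1.2 :=
      congrArg (fun x : TimedEntry S A => x.1.2) h.extend_last
    simp only [hl] at this
    simpa [hl] using this

/-- The timed policy consults the digitised selector at the current tick count; only its almost
optimal probabilistic choices cost `ε'`, while Markovian and idle moves cost nothing. -/
theorem value_digitise_le_pMax (s : S) :
    (M.digitise δ hδ).value G k (s, 0) ≤ ENNReal.ofReal (M.pMax s G (k * δ)) := by
  refine iSup_le fun m => ENNReal.le_of_forall_pos_le_add fun ε hε _ => ?_
  obtain ⟨ε', hε0, hmε⟩ := exists_ne_zero_natCast_mul_le m (ENNReal.coe_ne_zero.2 hε.ne')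
  set D := M.timedSelectorPolicy hδ G k hε0 m with hD
  have key := le_traj_reach (κ := D.step) (st := timedStatus) (B := timedTarget G (k * δ))
    (W := timedVal (M := M) hδ G k) (ε := ε') (N := m)
    (fun _ => (((Move.bot, Distr.dirac s), s), 0)) measurable_timedStatus dependsOn_timedStatus
    (measurableSet_timedTarget G _) (measurable_timedVal hδ G k)
    (fun n y => DigitisedMA.val_le_one _ G k n _)
    (fun y hy => DigitisedMA.val_zero_of_notMem _ G k
      fun h => hy ((mem_timedTarget_iff hδ).2 h))
    fun n hn π h => by
      rw [D.nextLIntegral_step (measurable_timedVal hδ G k _), hD]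
      simp only [timedSelectorPolicy]
      rw [Kernel.lintegral_deterministic' _ (measurable_timedGain
        (measurable_timedVal hδ G k _) _ _)]
      have hst : timedStatus n (Hist.extend (Preorder.frestrictLe (π := fun _ => TimedEntry S A)
          n π)) = timedStatus n π := dependsOn_timedStatus n fun i hi => Hist.extend_frestrictLe π hi
      rw [hst, show m - n = m - (n + 1) + 1 by omega]
      exact timedVal_succ_le hδ G k hε0 _ h
  have h0 : timedVal (M := M) hδ G k m (timedStatus 0 fun _ : ℕ =>
      ((((Move.bot, Distr.dirac s), s), 0) : TimedEntry S A)) =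
      (M.digitise δ hδ).val G k m (s, 0) := by
    simp [timedVal, timedStatus, entryTime, ticks_zero]
  rw [h0] at key
  refine key.trans (add_le_add ?_ hmε)
  change D.pathMeasure s (timedReach G (k * δ)) ≤ _
  rw [← ofReal_measureReal]
  refine ENNReal.ofReal_le_ofReal (le_ciSup (f := fun D : M.Policy =>
    (D.pathMeasure s).real (timedReach G (k * δ))) ⟨1, ?_⟩ D)
  rintro _ ⟨D', rfl⟩
  exact measureReal_le_one

end LowerBound

end MarkovAutomaton

namespace MarkovAutomaton

open MA

variable {S : Type*} {A : Type*} [Fintype S] {M : MarkovAutomaton S A} {δ : ℝ} (hδ : 0 < δ)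

/-! ### The digitised value with an error term is an upper bound -/

section UpperBound

variable (M) in
/-- The probability that at most one jump occurs in an interval of length `δ` if every jump has
the maximal exit rate. -/
def atMostOneJump (δ : ℝ) : ℝ := Real.exp (-(M.maxExitRate * δ)) * (1 + M.maxExitRate * δ)

lemma atMostOneJump_nonneg (hδ : 0 < δ) : 0 ≤ M.atMostOneJump δ := by
  have := mul_nonneg M.maxExitRate_nonneg hδ.le
  exact mul_nonneg (Real.exp_pos _).le (by linarith)

lemma atMostOneJump_le_one : M.atMostOneJump δ ≤ 1 := by
  rw [atMostOneJump, Real.exp_neg, inv_mul_le_one₀ (Real.exp_pos _), add_comm]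
  exact Real.add_one_le_exp _

variable (G : Set S) (k : ℕ)

variable (M) in
/-- A lower bound for the probability of avoiding `G` from state `s` after `c` digitisation
steps. -/
def avoidBound (s : S) (c : ℕ) : ℝ :=
  M.atMostOneJump δ ^ (k - c) - ((M.digitise δ hδ).value G k (s, c)).toReal

lemma value_ne_top (y : S × ℕ) : (M.digitise δ hδ).value G k y ≠ ∞ :=
  ((DigitisedMA.value_le_one _ G k y).trans_lt ENNReal.one_lt_top).ne

lemma avoidBound_le_one (s : S) (c : ℕ) : M.avoidBound hδ G k s c ≤ 1 := by
  have h1 : M.atMostOneJump δ ^ (k - c) ≤ 1 :=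
    pow_le_one₀ (atMostOneJump_nonneg hδ) atMostOneJump_le_one
  have h2 : 0 ≤ ((M.digitise δ hδ).value G k (s, c)).toReal := ENNReal.toReal_nonneg
  rw [avoidBound]
  linarith

lemma toReal_sum_ofReal_mul (μ : Distr S) {f : S → ℝ≥0∞} (hf : ∀ s, f s ≠ ∞) :
    (∑ s, ENNReal.ofReal (μ.1 s) * f s).toReal = ∑ s, μ.1 s * (f s).toReal := by
  rw [ENNReal.toReal_sum fun s _ => ENNReal.mul_ne_top ENNReal.ofReal_ne_top (hf s)]
  exact Finset.sum_congr rfl fun s _ => by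
    rw [ENNReal.toReal_mul, ENNReal.toReal_ofReal (μ.2.1 s)]

/-- Truncating differences at zero commutes with averaging up to an inequality. -/
lemma ofReal_sub_sum_le (μ : Distr S) {e : ℝ} (Q : ℝ) (v : S → ℝ) :
    ENNReal.ofReal (e * (Q - ∑ s, μ.1 s * v s)) ≤
      ∑ s, ENNReal.ofReal (μ.1 s) * ENNReal.ofReal (e * (Q - v s)) := by
  have h : e * (Q - ∑ s, μ.1 s * v s) = ∑ s, μ.1 s * (e * (Q - v s)) := by
    have hQ : Q = ∑ s, μ.1 s * Q := by rw [← Finset.sum_mul, μ.2.2, one_mul]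
    nth_rw 1 [hQ]
    rw [← Finset.sum_sub_distrib, Finset.mul_sum]
    exact Finset.sum_congr rfl fun s _ => by ring
  rw [h]
  refine (Finset.le_sum_of_subadditive ENNReal.ofReal ENNReal.ofReal_zero.le
    (fun _ _ => ENNReal.ofReal_add_le) _ _).trans_eq ?_
  exact Finset.sum_congr rfl fun s _ => ENNReal.ofReal_mul (μ.2.1 s)

open scoped Classical in
variable (M) in
/-- A lower bound for the probability of avoiding `G` up to time `k * δ` from a given state at a
given time. Between multiples of `δ` it allows no jump before the next multiple. -/
def avoid (y : S × ℝ≥0) : ℝ≥0∞ :=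
  if ticks δ y.2 ≤ k ∧ ¬ (y.1 ∉ M.PS ∧ y.1 ∉ M.MS ∧ y.1 ∉ G) then
    ENNReal.ofReal (Real.exp (-(M.maxExitRate * (ticks δ y.2 * δ - y.2))) *
      M.avoidBound hδ G k y.1 (ticks δ y.2))
  else 1

lemma exp_ticks_le_one (hδ : 0 < δ) (T : ℝ≥0) :
    Real.exp (-(M.maxExitRate * (ticks δ T * δ - T))) ≤ 1 := by
  rw [Real.exp_le_one_iff, neg_nonpos]
  exact mul_nonneg M.maxExitRate_nonneg (sub_nonneg.2 (le_ticks_mul hδ T))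

lemma exp_mul_avoidBound_le_one (T : ℝ≥0) (s : S) (c : ℕ) :
    Real.exp (-(M.maxExitRate * (ticks δ T * δ - T))) * M.avoidBound hδ G k s c ≤ 1 :=
  (mul_le_of_le_one_right (Real.exp_pos _).le (avoidBound_le_one hδ G k s c)).trans
    (exp_ticks_le_one hδ T)

lemma avoid_le_one (y : S × ℝ≥0) : M.avoid hδ G k y ≤ 1 := by
  rw [avoid]
  split_ifs
  · exact ENNReal.ofReal_le_one.2 (exp_mul_avoidBound_le_one hδ G k _ _ _)
  · exact le_rfl

lemma ofReal_le_avoid (y : S × ℝ≥0) :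
    ENNReal.ofReal (Real.exp (-(M.maxExitRate * (ticks δ y.2 * δ - y.2))) *
      M.avoidBound hδ G k y.1 (ticks δ y.2)) ≤ M.avoid hδ G k y := by
  rw [avoid]
  split_ifs
  · exact le_rfl
  · exact ENNReal.ofReal_le_one.2 (exp_mul_avoidBound_le_one hδ G k _ _ _)

lemma avoid_of_lt {y : S × ℝ≥0} (h : k < ticks δ y.2) : M.avoid hδ G k y = 1 := by
  rw [avoid, if_neg fun h' => absurd h'.1 (by omega)]

/-- Idle states need a separate value: a round of idling lasts time 1, which need not be a multiple
of `δ`, so the weight up to the next grid point could make the general formula decrease. -/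
lemma avoid_idle {s : S} (h1 : s ∉ M.PS) (h2 : s ∉ M.MS) (h3 : s ∉ G) (T : ℝ≥0) :
    M.avoid hδ G k (s, T) = 1 := by
  rw [avoid, if_neg fun h' => h'.2 ⟨h1, h2, h3⟩]

lemma avoid_eq_zero {y : S × ℝ≥0} (h : y ∈ timedTarget G (k * δ)) : M.avoid hδ G k y = 0 := by
  have h' := (mem_timedTarget_iff hδ).1 h
  rw [avoid, if_pos ⟨h'.2, fun h3 => h3.2.2 h'.1⟩, ENNReal.ofReal_eq_zero]
  refine mul_nonpos_of_nonneg_of_nonpos (Real.exp_pos _).le ?_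
  rw [avoidBound, DigitisedMA.value_of_mem _ G k h', ENNReal.toReal_one, sub_nonpos]
  exact pow_le_one₀ (atMostOneJump_nonneg hδ) atMostOneJump_le_one

/-- Let `Q = q^{k-(c+1)}`, `e = e^{-Eδ}`, and let `X` be the mean value after a jump. The Bellman
inequality gives `value (s, c) ≥ (1 - e) X + e * value (s, c + 1)`. Now `q ≤ oneJump + e` bounds `q
* Q`, and `oneJump ≤ 1 - e` with `X ≥ 0` allows replacing `1 - e` by `oneJump` in front of `X`. -/
lemma avoidBound_le_add {s : S} (hs : s ∈ M.MS) (hG : s ∉ G) {c : ℕ} (hc : c < k) :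
    M.avoidBound hδ G k s c ≤
      oneJump (M.exitRate s) M.maxExitRate δ *
          (M.atMostOneJump δ ^ (k - (c + 1)) - ∑ s', (M.jump s).1 s' *
            ((M.digitise δ hδ).value G k (s', c + 1)).toReal) +
        Real.exp (-(M.exitRate s * δ)) * M.avoidBound hδ G k s (c + 1) := by
  have hB : (s, c) ∉ stepTarget G k := fun h => hG h.1
  have hle := (M.digitise δ hδ).gain_value_le G k hB ((enabled_digitise_of_mem_MS hδ hs).2 rfl)
  have h1e : 0 ≤ 1 - Real.exp (-(M.exitRate s * δ)) := by
    rw [sub_nonneg, Real.exp_le_one_iff, neg_nonpos]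
    exact mul_nonneg (M.exitRate_nonneg s) hδ.le
  have hfin : ∑ s', ENNReal.ofReal ((M.jump s).1 s') * (M.digitise δ hδ).value G k (s', c + 1)
      ≠ ∞ :=
    ENNReal.sum_ne_top.2 fun s' _ =>
      ENNReal.mul_ne_top ENNReal.ofReal_ne_top (value_ne_top hδ G k _)
  rw [gain_digitJump] at hle
  have hle' := ENNReal.toReal_mono (value_ne_top hδ G k _) hle
  rw [ENNReal.toReal_add (ENNReal.mul_ne_top ENNReal.ofReal_ne_top hfin)
    (ENNReal.mul_ne_top ENNReal.ofReal_ne_top (value_ne_top hδ G k _)), ENNReal.toReal_mul,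
    ENNReal.toReal_mul, ENNReal.toReal_ofReal h1e, ENNReal.toReal_ofReal (Real.exp_pos _).le,
    toReal_sum_ofReal_mul (M.jump s) fun s' => value_ne_top hδ G k (s', c + 1)] at hle'
  have hX : 0 ≤ ∑ s', (M.jump s).1 s' * ((M.digitise δ hδ).value G k (s', c + 1)).toReal :=
    Finset.sum_nonneg fun s' _ => mul_nonneg ((M.jump s).2.1 s') ENNReal.toReal_nonneg
  have hA := oneJump_le (M.exitRate_pos hs) M.maxExitRate_nonneg hδ.le
  have hq := le_oneJump_add M.maxExitRate_nonneg (M.exitRate_le_max hs) hδ.le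
  have hQ : 0 ≤ M.atMostOneJump δ ^ (k - (c + 1)) := pow_nonneg (atMostOneJump_nonneg hδ) _
  have hpow : M.atMostOneJump δ ^ (k - c) =
      M.atMostOneJump δ * M.atMostOneJump δ ^ (k - (c + 1)) := by
    rw [← pow_succ']; congr 1; omega
  rw [avoidBound, avoidBound, hpow]
  have hqQ := mul_le_mul_of_nonneg_right hq hQ
  have hAX := mul_le_mul_of_nonneg_right hA hX
  rw [← atMostOneJump] at hqQ
  simp only at hle'
  nlinarith

variable [MeasurableSpace S] [DiscreteMeasurableSpace S]

lemma measurable_avoid : Measurable (M.avoid hδ G k) := by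
  have ht : Measurable fun y : S × ℝ≥0 => ticks δ y.2 := (measurable_ticks δ).comp measurable_snd
  have htr : Measurable fun y : S × ℝ≥0 => (ticks δ y.2 : ℝ) :=
    (Measurable.of_discrete (f := fun n : ℕ => (n : ℝ))).comp ht
  refine Measurable.ite ?_ (ENNReal.measurable_ofReal.comp (Measurable.mul ?_ ?_)) measurable_const
  · exact (MeasurableSet.of_discrete (s := {z : S × ℕ | z.2 ≤ k ∧
      ¬ (z.1 ∉ M.PS ∧ z.1 ∉ M.MS ∧ z.1 ∉ G)})).preimage (measurable_fst.prodMk ht)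
  · exact Real.measurable_exp.comp (((htr.mul_const δ).sub
      (measurable_coe_nnreal_real.comp measurable_snd)).const_mul _).neg
  · exact (Measurable.of_discrete (f := fun z : S × ℕ => M.avoidBound hδ G k z.1 z.2)).comp
      (measurable_fst.prodMk ht)

lemma one_le_timedGain_avoid {s : S} (hs : s ∈ M.MS) {T : ℝ≥0}
    (h : ∀ t > 0, k < ticks δ (T + t)) :
    1 ≤ M.timedGain (M.avoid hδ G k) s T ((.bot, M.jump s) : Move A × Distr S) := by
  rw [timedGain_markov _ hs]
  have hone : ∫⁻ _, 1 ∂(expMeasure (M.exitRate s)).map Real.toNNReal = 1 := by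
    have := isProbabilityMeasure_expMeasure (M.exitRate_pos hs)
    have := Measure.isProbabilityMeasure_map (μ := expMeasure (M.exitRate s))
      measurable_real_toNNReal.aemeasurable
    simp
  refine hone.symm.trans_le ?_
  rw [lintegral_expMeasure_map_toNNReal _ measurable_const, lintegral_expMeasure_map_toNNReal _
    (measurable_sum_ofReal_mul (measurable_avoid (M := M) hδ G k) (M.jump s) T)]
  refine setLIntegral_mono' measurableSet_Ioi fun t ht => ?_
  gcongr
  rw [← sum_ofReal_distr (M.jump s)]
  refine Finset.sum_le_sum fun s' _ => ?_
  rw [avoid_of_lt hδ G k (y := (s', T + t.toNNReal)) (h _ (Real.toNNReal_pos.2 ht)), mul_one]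

/-- Induction on the grid intervals left. A jump at offset `t` has density `E e^{-Et}`, and `avoid`
then supplies `e^{-λ(δ-t)}` up to the next grid point; together they integrate to `oneJump`.
Surviving the interval leads to the next grid point. -/
lemma le_timedGain_avoid_of_nat_mul {s : S} (hs : s ∈ M.MS) (hG : s ∉ G) {c : ℕ} (hc : c ≤ k)
    {T : ℝ≥0} (hT : (T : ℝ) = c * δ) :
    ENNReal.ofReal (M.avoidBound hδ G k s c) ≤
      M.timedGain (M.avoid hδ G k) s T ((.bot, M.jump s) : Move A × Distr S) := by
  rw [timedGain_markov _ hs]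
  have hm := fun T => measurable_sum_ofReal_mul (measurable_avoid (M := M) hδ G k) (M.jump s) T
  have hpos : ∀ {t : ℝ}, 0 < t → 0 < t.toNNReal := fun h => Real.toNNReal_pos.2 h
  obtain ⟨d, hd⟩ := Nat.exists_eq_add_of_le hc
  induction d generalizing c T with
  | zero =>
    -- Here `c = k`: every positive sojourn ends after the time bound, where `avoid` is 1.
    refine (ENNReal.ofReal_le_one.2 (avoidBound_le_one hδ G k s c)).trans ?_
    rw [← timedGain_markov _ hs]
    refine one_le_timedGain_avoid hδ G k hs fun t ht => not_le.1 fun h => ?_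
    rw [ticks_le_iff hδ, show k = c by omega] at h
    have h2 : (0 : ℝ) < t := ht
    push_cast at h
    linarith
  | succ d ih =>
    have hδ' : ((δ.toNNReal : ℝ≥0) : ℝ) = δ := Real.coe_toNNReal _ hδ.le
    have ih' := ih (c := c + 1) (by omega) (T := T + δ.toNNReal)
      (by push_cast; rw [hδ', hT]; ring) (by omega)
    rw [lintegral_exp_eq_add _ (hm T) δ.toNNReal, hδ']
    refine (ENNReal.ofReal_le_ofReal
      (avoidBound_le_add hδ G k hs hG (by omega))).trans (ENNReal.ofReal_add_le.trans ?_)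
    refine add_le_add ?_ ?_
    · rw [ENNReal.ofReal_mul (oneJump_nonneg (M.exitRate_nonneg s) _ hδ.le),
        ← lintegral_Ioc_oneJump (M.exitRate_nonneg s) _ hδ.le,
        ← lintegral_mul_const _ (by fun_prop)]
      refine setLIntegral_mono' measurableSet_Ioc fun t ht => ?_
      have ht' : ((t.toNNReal : ℝ≥0) : ℝ) = t := Real.coe_toNNReal _ ht.1.le
      have htick : ticks δ (T + t.toNNReal) = c + 1 :=
        ticks_nat_mul_add hδ hT (hpos ht.1) (ht'.trans_le ht.2)
      rw [ENNReal.ofReal_mul (mul_nonneg (M.exitRate_nonneg s) (Real.exp_pos _).le), mul_assoc,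
        ← ENNReal.ofReal_mul (Real.exp_pos _).le]
      gcongr
      refine (ofReal_sub_sum_le (M.jump s) _ _).trans (Finset.sum_le_sum fun s' _ => ?_)
      gcongr
      -- The next grid point after the jump is `(c + 1) δ`, at distance `δ - t`.
      refine le_trans (le_of_eq ?_) (ofReal_le_avoid hδ G k (s', T + t.toNNReal))
      simp only [htick, avoidBound, NNReal.coe_add, ht', hT]
      congr 4
      push_cast
      ring
    · rw [ENNReal.ofReal_mul (Real.exp_pos _).le]
      simp only [← add_assoc]
      gcongr

/-- Surviving until the next grid point has probability `e^{-Eτ} ≥ e^{-λτ}`, the weight built into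
`avoid`; jumps before that point are discarded. -/
lemma avoid_le_timedGain_of_mem_MS {s : S} (hs : s ∈ M.MS) (hG : s ∉ G) {T : ℝ≥0}
    (hT : ticks δ T ≤ k) :
    M.avoid hδ G k (s, T) ≤
      M.timedGain (M.avoid hδ G k) s T ((.bot, M.jump s) : Move A × Distr S) := by
  set τ : ℝ := ticks δ T * δ - T with hτ
  have hτ0 : 0 ≤ τ := sub_nonneg.2 (le_ticks_mul hδ T)
  have hτ' : ((τ.toNNReal : ℝ≥0) : ℝ) = τ := Real.coe_toNNReal _ hτ0
  have key := le_timedGain_avoid_of_nat_mul hδ G k hs hG hT (T := T + τ.toNNReal)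
    (by push_cast; rw [hτ']; ring)
  rw [timedGain_markov _ hs] at key ⊢
  rw [lintegral_exp_eq_add _ (measurable_sum_ofReal_mul (measurable_avoid hδ G k) _ T) τ.toNNReal]
  refine le_trans ?_ le_add_self
  simp only [add_assoc] at key
  rw [avoid, if_pos ⟨hT, fun h => h.2.1 hs⟩, ENNReal.ofReal_mul (Real.exp_pos _).le, hτ']
  refine mul_le_mul' (ENNReal.ofReal_le_ofReal (Real.exp_le_exp.2 (neg_le_neg ?_))) key
  exact mul_le_mul_of_nonneg_right (M.exitRate_le_max hs) hτ0

/-- Probabilistic moves change neither time nor step count, so excessiveness of `value` and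
subadditivity of truncation suffice; beyond the time bound `avoid` is constantly 1. -/
lemma avoid_le_timedGain {s : S} {T : ℝ≥0} (h : (s, T) ∉ timedTarget G (k * δ))
    {x : Move A × Distr S} (hx : M.Enabled s x) :
    M.avoid hδ G k (s, T) ≤ M.timedGain (M.avoid hδ G k) s T x := by
  rw [mem_timedTarget_iff hδ] at h
  have hm := measurable_avoid (M := M) hδ G k
  by_cases hPS : s ∈ M.PS
  · obtain ⟨a, μ, rfl, hit⟩ := enabled_of_mem_PS hPS hx
    rw [timedGain_act _ _ _ _ _ hm]
    by_cases hk : ticks δ T ≤ k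
    · have hle := (M.digitise δ hδ).gain_value_le G k h (x := (.act a, μ)) hit
      have hle' := ENNReal.toReal_mono (value_ne_top hδ G k _) hle
      rw [gain, toReal_sum_ofReal_mul μ fun s' => value_ne_top hδ G k _] at hle'
      simp only [Move.cost, add_zero] at hle'
      rw [avoid, if_pos ⟨hk, fun h' => h'.1 hPS⟩]
      refine le_trans (ENNReal.ofReal_le_ofReal (mul_le_mul_of_nonneg_left
        (sub_le_sub_left hle' _) (Real.exp_pos _).le)) ?_
      refine (ofReal_sub_sum_le μ _ _).trans (Finset.sum_le_sum fun s' _ => ?_)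
      gcongr
      exact ofReal_le_avoid hδ G k (s', T)
    · refine (avoid_le_one hδ G k _).trans ?_
      rw [← sum_ofReal_distr μ]
      refine Finset.sum_le_sum fun s' _ => ?_
      rw [avoid_of_lt hδ G k (y := (s', T)) (not_le.1 hk), mul_one]
  rw [enabled_of_notMem_PS hPS hx]
  by_cases hMS : s ∈ M.MS
  · by_cases hk : ticks δ T ≤ k
    · exact avoid_le_timedGain_of_mem_MS hδ G k hMS (fun hG => h ⟨hG, hk⟩) hk
    · exact (avoid_le_one hδ G k _).trans (one_le_timedGain_avoid hδ G k hMS fun t _ =>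
        (not_le.1 hk).trans_le (ticks_mono hδ le_self_add))
  · rw [timedGain_idle _ hMS _ hm]
    by_cases hG : s ∈ G
    · have hk : k < ticks δ T := not_le.1 fun hk => h ⟨hG, hk⟩
      rw [avoid_of_lt hδ G k (y := (s, T + 1))]
      · exact avoid_le_one hδ G k _
      · exact hk.trans_le (ticks_mono hδ le_self_add)
    · rw [avoid_idle hδ G k hPS hMS hG (T + 1)]
      exact avoid_le_one hδ G k _

variable [Finite A]

lemma pMax_le_value_digitise_add (s : S) :
    M.pMax s G (k * δ) ≤
      ((M.digitise δ hδ).value G k (s, 0)).toReal + (1 - M.atMostOneJump δ ^ k) := by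
  have hbd := avoidBound_le_one (M := M) hδ G k s 0
  have heq : ((M.digitise δ hδ).value G k (s, 0)).toReal + (1 - M.atMostOneJump δ ^ k) =
      1 - M.avoidBound hδ G k s 0 := by
    rw [avoidBound, Nat.sub_zero]; ring
  rw [heq]
  refine Real.iSup_le (fun D => ?_) (by linarith)
  have key := traj_reach_le_one_sub (κ := D.step) (st := timedStatus)
    (B := timedTarget G (k * δ)) (a := M.avoid hδ G k)
    (fun _ => (((Move.bot, Distr.dirac s), s), 0)) measurable_timedStatus dependsOn_timedStatus
    (measurableSet_timedTarget G _) (measurable_avoid hδ G k) (avoid_le_one hδ G k)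
    (fun y hy => avoid_eq_zero hδ G k hy) fun n π h => by
      rw [D.nextLIntegral_step (measurable_avoid hδ G k)]
      have hen := D.enabled n (Preorder.frestrictLe (π := fun _ => TimedEntry S A) n π)
      have hle : ∀ᵐ x ∂D.choice n (Preorder.frestrictLe (π := fun _ => TimedEntry S A) n π),
          M.avoid hδ G k (timedStatus n π) ≤
            M.timedGain (M.avoid hδ G k) (π n).1.2 (entryTime π n) x := by
        filter_upwards [hen] with x hx using avoid_le_timedGain hδ G k h hx
      exact le_trans (by simp) (lintegral_mono_ae hle)
  have h0 := ofReal_le_avoid (M := M) hδ G k (s, 0)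
  simp only [ticks_zero, Nat.cast_zero, zero_mul, NNReal.coe_zero, sub_zero, mul_zero, neg_zero,
    Real.exp_zero, one_mul] at h0
  have hst : timedStatus 0 (fun _ : ℕ =>
      ((((Move.bot, Distr.dirac s), s), 0) : TimedEntry S A)) = (s, 0) := by
    simp [timedStatus, entryTime]
  rw [hst] at key
  refine ENNReal.toReal_le_of_le_ofReal (by linarith) (key.trans ?_)
  refine (tsub_le_tsub_left h0 1).trans ?_
  rw [tsub_le_iff_right, ← ENNReal.ofReal_one]
  -- Subadditivity of `ENNReal.ofReal` also covers a negative `avoidBound`.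
  exact (ENNReal.ofReal_le_ofReal (by linarith)).trans ENNReal.ofReal_add_le

end UpperBound

end MarkovAutomaton

end

/-! ### The two-sided error bound -/

theorem theorem6 {S A : Type*} [Fintype S] [Finite A] [MeasurableSpace S]
    [DiscreteMeasurableSpace S] (M : MarkovAutomaton S A) (G : Set S) (b δ : ℝ) (k : ℕ)
    (hδ : 0 < δ) (hb : b = k * δ) (s : S) :
    (M.digitise δ hδ).pMax s G k ≤ M.pMax s G b ∧
      M.pMax s G b ≤ (M.digitise δ hδ).pMax s G k +
        (1 - Real.exp (-(M.maxExitRate * b)) * (1 + M.maxExitRate * δ) ^ k) := by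
  subst hb
  constructor
  · refine (DigitisedMA.pMax_le_value s).trans ?_
    exact ENNReal.toReal_le_of_le_ofReal (Real.iSup_nonneg fun _ => measureReal_nonneg)
      (MarkovAutomaton.value_digitise_le_pMax hδ G k s)
  · have hq : Real.exp (-(M.maxExitRate * (k * δ))) * (1 + M.maxExitRate * δ) ^ k =
        M.atMostOneJump δ ^ k := by
      rw [MarkovAutomaton.atMostOneJump, mul_pow, ← Real.exp_nat_mul]
      congr 2
      ring
    rw [hq]
    refine (MarkovAutomaton.pMax_le_value_digitise_add hδ G k s).trans (add_le_add_left ?_ _)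
    exact ENNReal.toReal_le_of_le_ofReal (Real.iSup_nonneg fun _ => measureReal_nonneg)
      (DigitisedMA.value_le_pMax s)
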